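/- Let $a,b\ge 0$ be constants and $\alpha=(a+b)/2$. For each $n$ let $\sigma=(\sigma_i)_{1\le i\le n}$ be i.i.d. uniform spins in $\{-1,+1\}$ and, given $\sigma$, let $\mathcal G$ be the random graph on $\{1,\dots,n\}$ in which each pair $i\ne j$ is independently joined by an edge with probability $a/n$ if $\sigma_i=\sigma_j$ and $b/n$ if $\sigma_i=-\sigma_j$ (truncated at $1$ for the finitely many $n<\max(a,b)$). Let $A$ be its adjacency matrix and $\bar A=\mathbb E[A\mid\sigma]$, that is, for $n\ge\max(a,b)$, $\bar A=\frac an\left[\frac12(ee'+\sigma\sigma')-I\right]+\frac b{2n}(ee'-\sigma\sigma')$, where $e$ is the all-ones vector. For $\ell\ge 0$ let $B^{(\ell)}_{ij}$ be the number of self-avoiding paths of $\ell$ edges of $\mathcal G$ from $i$ to $j$, and let $$\Delta^{(\ell)}_{ij}=\sum_{i_0^\ell\in P_{ij}}\prod_{t=1}^{\ell}(A-\bar A)_{i_{t-1}i_t},$$ where $P_{ij}$ is the set of sequences $i_0^\ell=(i_0,\dots,i_\ell)$ of distinct nodes with $i_0=i$, $i_\ell=j$. For $1\le m\le\ell$ let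 $$\Gamma^{\ell,m}_{ij}=\sum_{i_0^\ell\in R^m_{ij}}\ \prod_{t=1}^{\ell-m}(A-\bar A)_{i_{t-1}i_t}\ \bar A_{i_{\ell-m}i_{\ell-m+1}}\prod_{t=\ell-m+2}^{\ell}A_{i_{t-1}i_t},$$ where $R^m_{ij}$ is the set of sequences of nodes with $i_0=i$, $i_\ell=j$ such that $i_0,\dots,i_{\ell-m}$ are distinct and $i_{\ell-m+1},\dots,i_\ell$ are distinct, but $i_0,\dots,i_\ell$ are not all distinct. Write $\rho(M)$ for the spectral norm (largest singular value) of $M$; it is an upper bound for the modulus of every eigenvalue of $M$, and for symmetric $M$ it is the spectral radius. **Theorem.** For all $n$ and $\ell\ge 0$, and for every realization of the spins and the graph, $$B^{(\ell)}=\Delta^{(\ell)}+\sum_{m=1}^{\ell}\Delta^{(\ell-m)}\bar A\,B^{(m-1)}-\sum_{m=1}^{\ell}\Gamma^{\ell,m}.$$ Moreover, if $\alpha\ge 1$, then for all constants $C$ and $\epsilon>0$, with probability tending to $1$ as $n\to\infty$, the following holds simultaneously for all integers $0\le\ell\le C\log n$: $$\rho(\Delta^{(\ell)})\le n^{\epsilon}\alpha^{\ell/2},\qquad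 \rho(\Gamma^{\ell,m})\le n^{\epsilon-1}\alpha^{(\ell+m)/2}\quad (m=1,\dots,\ell).$$ -/

import Mathlib

open scoped ENNReal Topology

noncomputable section

namespace SBM

/-- The value `±1` of a spin, as a real number. -/
def spinVal (x : ℤˣ) : ℝ := ((x : ℤ) : ℝ)

/-- Probability that two nodes with spins `x`, `y` are joined: `a / n` for equal spins, `b / n`
for opposite ones.  (It is truncated at `1`, so that the model also makes sense for the finitely
many `n < max a b`.) -/
def edgeProb (a b : ℝ) (n : ℕ) (x y : ℤˣ) : ℝ≥0∞ :=
  min 1 (ENNReal.ofReal ((if x = y then a else b) / n))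

/-- The unordered pairs of distinct nodes. -/
abbrev Pairs (n : ℕ) : Type := {p : Fin n × Fin n // p.1 < p.2}

/-- Weight of the edge configuration `ξ`, given the spins `s`: the edges are independent. -/
def configWeight (a b : ℝ) (n : ℕ) (s : Fin n → ℤˣ) (ξ : Pairs n → Bool) : ℝ≥0∞ :=
  ∏ p : Pairs n, (if ξ p then edgeProb a b n (s p.1.1) (s p.1.2)
    else 1 - edgeProb a b n (s p.1.1) (s p.1.2))

theorem sum_configWeight (a b : ℝ) (n : ℕ) (s : Fin n → ℤˣ) :
    ∑ ξ : Pairs n → Bool, configWeight a b n s ξ = 1 := by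
  have h := (Finset.prod_univ_sum (fun _ : Pairs n => (Finset.univ : Finset Bool))
    (fun p c => if c then edgeProb a b n (s p.1.1) (s p.1.2)
      else 1 - edgeProb a b n (s p.1.1) (s p.1.2))).symm
  rw [Fintype.piFinset_univ] at h
  unfold configWeight
  rw [h]
  refine Finset.prod_eq_one fun p _ => ?_
  simp [edgeProb]

/-- Law of the edge configuration, given the spins. -/
def configLaw (a b : ℝ) (n : ℕ) (s : Fin n → ℤˣ) : PMF (Pairs n → Bool) :=
  PMF.ofFintype (configWeight a b n s) (sum_configWeight a b n s)

/-- The graph with the given edge configuration. -/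
def graphOf {n : ℕ} (ξ : Pairs n → Bool) : SimpleGraph (Fin n) :=
  SimpleGraph.fromRel fun i j => ∃ h : i < j, ξ ⟨(i, j), h⟩ = true

/-- Law of the graph, given the spins. -/
def graphLaw (a b : ℝ) (n : ℕ) (s : Fin n → ℤˣ) : PMF (SimpleGraph (Fin n)) :=
  (configLaw a b n s).map graphOf

/-- The stochastic block model: the joint law of the i.i.d. uniform spins and of the graph. -/
def law (a b : ℝ) (n : ℕ) : PMF ((Fin n → ℤˣ) × SimpleGraph (Fin n)) :=
  (PMF.uniformOfFintype (Fin n → ℤˣ)).bind fun s => (graphLaw a b n s).map (Prod.mk s)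

open Classical in
/-- The adjacency matrix `A`. -/
def adj {n : ℕ} (G : SimpleGraph (Fin n)) : Matrix (Fin n) (Fin n) ℝ := G.adjMatrix ℝ

open Classical in
/-- The conditional expectation of the adjacency matrix, given that the spins are `s`. -/
def meanAdj (a b : ℝ) (n : ℕ) (s : Fin n → ℤˣ) : Matrix (Fin n) (Fin n) ℝ :=
  ∑ G : SimpleGraph (Fin n), (graphLaw a b n s G).toReal • adj G

/-- `B^{(ℓ)}`: the entry `(i, j)` is the number of self-avoiding paths of `ℓ` edges of `G` from
`i` to `j`, a path being given by its sequence of nodes. -/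
def pathMatrix {n : ℕ} (G : SimpleGraph (Fin n)) (ℓ : ℕ) : Matrix (Fin n) (Fin n) ℝ :=
  Matrix.of fun i j => (Nat.card {p : Fin (ℓ + 1) → Fin n //
    Function.Injective p ∧ p 0 = i ∧ p (Fin.last ℓ) = j ∧
      ∀ t : Fin ℓ, G.Adj (p t.castSucc) (p t.succ)} : ℝ)

open Classical in
/-- `Δ^{(ℓ)}`, for the graph `G` and the spins `s`. -/
def deltaMatrix (a b : ℝ) {n : ℕ} (s : Fin n → ℤˣ) (G : SimpleGraph (Fin n)) (ℓ : ℕ) :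
    Matrix (Fin n) (Fin n) ℝ :=
  Matrix.of fun i j =>
    ∑ p : Fin (ℓ + 1) → Fin n with
      Function.Injective p ∧ p 0 = i ∧ p (Fin.last ℓ) = j,
      ∏ t : Fin ℓ, (adj G - meanAdj a b n s) (p t.castSucc) (p t.succ)

open Classical in
/-- `Γ^{ℓ,m}`, for the graph `G` and the spins `s` (`1 ≤ m ≤ ℓ`).  The sum is over the sequences
`p 0, …, p ℓ` which are not self-avoiding, while `p 0, …, p (ℓ - m)` and `p (ℓ - m + 1), …, p ℓ`
both are.  The step number `t`, counted from `0`, goes from `p t` to `p (t + 1)`. -/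
def gammaMatrix (a b : ℝ) {n : ℕ} (s : Fin n → ℤˣ) (G : SimpleGraph (Fin n)) (ℓ m : ℕ) :
    Matrix (Fin n) (Fin n) ℝ :=
  Matrix.of fun i j =>
    ∑ p : Fin (ℓ + 1) → Fin n with
      Set.InjOn p {t : Fin (ℓ + 1) | (t : ℕ) ≤ ℓ - m} ∧
          Set.InjOn p {t : Fin (ℓ + 1) | ℓ - m < (t : ℕ)} ∧
          ¬ Function.Injective p ∧ p 0 = i ∧ p (Fin.last ℓ) = j,
      ∏ t : Fin ℓ,
        (if (t : ℕ) < ℓ - m then adj G - meanAdj a b n s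
          else if (t : ℕ) = ℓ - m then meanAdj a b n s
          else adj G) (p t.castSucc) (p t.succ)

/-- The spectral norm of a square matrix: its operator norm for the Euclidean norm. -/
def specNorm {n : ℕ} (M : Matrix (Fin n) (Fin n) ℝ) : ℝ :=
  ‖Matrix.toEuclideanCLM (n := Fin n) (𝕜 := ℝ) M‖

/-- The event that the bounds on `Δ^{(ℓ)}` and on `Γ^{ℓ,m}`, `m = 1, …, ℓ`, hold for all path
lengths `ℓ ≤ C log n`. -/
def goodEvent (a b C ε : ℝ) (n : ℕ) : Set ((Fin n → ℤˣ) × SimpleGraph (Fin n)) :=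
  {ω | ∀ ℓ : ℕ, (ℓ : ℝ) ≤ C * Real.log n →
    specNorm (deltaMatrix a b ω.1 ω.2 ℓ)
        ≤ (n : ℝ) ^ ε * ((a + b) / 2) ^ ((ℓ : ℝ) / 2) ∧
      ∀ m ∈ Finset.Icc 1 ℓ, specNorm (gammaMatrix a b ω.1 ω.2 ℓ m)
        ≤ (n : ℝ) ^ (ε - 1) * ((a + b) / 2) ^ (((ℓ : ℝ) + m) / 2)}

end SBM

end

noncomputable section

namespace SBM

/-! The expansion telescopes. Replacing the factors `A` along a sequence by `A - Ā`, one at a time,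
writes the product of the `A`'s as the fully centred product plus the products in which one step is
averaged, the earlier ones are centred and the later ones are not (`prod_adj_eq_sum_blockWeight`).
The matrix product `Δ Ā B` sums the same weights over sequences whose two pieces are separately
self-avoiding; `Γ` is the part where the pieces meet (`delta_mul_mean_mul_path_eq`).

The bounds use the moment method with a fixed power K = 2^(j+2) such that Kε ≥ 3. Both kinds of
matrices are a `blockMatrix`, with `cut = ℓ` for `Δ` and `cut = ℓ - m` for `Γ`; put m = 0 for `Δ`.
The K-th power of the norm is at most a trace, which is a sum over closed chains of K sequences. Let
a chain visit v nodes and use e edges, averaged steps left out. Given the spins, its expectation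
vanishes if some edge is traversed only once, by a centred step; otherwise e ≤ K(ℓ+m)/2, and the
expectation is at most the product of the edge probabilities, times O(1/n)^K for the averaged steps
when m ≥ 1 (`abs_expectation_family_le`). Averaging over the spins strips a spanning tree leaf by
leaf, each tree edge giving exactly α/n, while each of the e-(v-1) excess edges gives at most
max(a,b)/n (`sum_prod_spinWeight_le`). As α ≥ 1, the tree contributes at most n · n^(-v) ·
α^(K(ℓ+m)/2).

It remains to count chains. The concatenated walk, of L steps, is determined by one symbol per step
and by the names of its v nodes in order of discovery. If every step whose symbol differs from the
previous one is given the weight z, the sum over walks of n^(-v) z^(changes) is at most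
(1+(2L+2)z)^L (`sum_weight_stepCode_le`), which is bounded for 1/z of order (log n)². The number of
changes is at most a constant plus 12K(e-(v-1)) (`card_stepCode_familyWalk_le`), so the factors
max(a,b)/n of the excess edges pay for the inverse powers of z. The normalized moment is then at
most n² · polylog(n) / n^(Kε), and Markov's inequality with a union bound over ℓ and m concludes. -/

/-! ### Edge probabilities and the conditional mean of the adjacency matrix. -/

/-- The edge probability as a real number. -/
def edgePr (a b : ℝ) (n : ℕ) (x y : ℤˣ) : ℝ := (edgeProb a b n x y).toReal

lemma edgeProb_le_one (a b : ℝ) (n : ℕ) (x y : ℤˣ) : edgeProb a b n x y ≤ 1 := min_le_left _ _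

lemma edgePr_nonneg (a b : ℝ) (n : ℕ) (x y : ℤˣ) : 0 ≤ edgePr a b n x y := ENNReal.toReal_nonneg

lemma edgePr_le_one (a b : ℝ) (n : ℕ) (x y : ℤˣ) : edgePr a b n x y ≤ 1 := by
  simpa [edgePr] using ENNReal.toReal_mono ENNReal.one_ne_top (edgeProb_le_one a b n x y)

lemma edgePr_comm (a b : ℝ) (n : ℕ) (x y : ℤˣ) : edgePr a b n x y = edgePr a b n y x := by
  simp [edgePr, edgeProb, eq_comm]

lemma edgePr_eq {a b : ℝ} {n : ℕ} (ha : 0 ≤ a) (hb : 0 ≤ b) (hn : max a b ≤ n) (x y : ℤˣ) :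
    edgePr a b n x y = (if x = y then a else b) / n := by
  have h0 : 0 ≤ (if x = y then a else b) / (n : ℝ) := by
    split_ifs <;> positivity
  have h1 : (if x = y then a else b) / (n : ℝ) ≤ 1 := by
    apply div_le_one_of_le₀ _ (Nat.cast_nonneg n)
    split_ifs
    · exact (le_max_left _ _).trans hn
    · exact (le_max_right _ _).trans hn
  rw [edgePr, edgeProb, min_eq_right, ENNReal.toReal_ofReal h0]
  simpa using ENNReal.ofReal_le_ofReal h1

lemma configWeight_toReal (a b : ℝ) (n : ℕ) (s : Fin n → ℤˣ) (ξ : Pairs n → Bool) :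
    (configWeight a b n s ξ).toReal =
      ∏ p : Pairs n, (if ξ p then edgePr a b n (s p.1.1) (s p.1.2)
        else 1 - edgePr a b n (s p.1.1) (s p.1.2)) := by
  rw [configWeight, ENNReal.toReal_prod]
  refine Finset.prod_congr rfl fun p _ => ?_
  split_ifs
  · rfl
  · rw [ENNReal.toReal_sub_of_le (edgeProb_le_one _ _ _ _ _) ENNReal.one_ne_top]
    rfl

lemma sum_graphLaw_mul (a b : ℝ) (n : ℕ) (s : Fin n → ℤˣ) (f : SimpleGraph (Fin n) → ℝ) :
    ∑ G, (graphLaw a b n s G).toReal * f G =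
      ∑ ξ : Pairs n → Bool, (∏ p : Pairs n, (if ξ p then edgePr a b n (s p.1.1) (s p.1.2)
        else 1 - edgePr a b n (s p.1.1) (s p.1.2))) * f (graphOf ξ) := by
  classical
  have h : ∀ G, (graphLaw a b n s G).toReal =
      ∑ ξ : Pairs n → Bool, if G = graphOf ξ then (configWeight a b n s ξ).toReal else 0 := by
    intro G
    rw [graphLaw, PMF.map_apply, tsum_fintype, ENNReal.toReal_sum]
    · refine Finset.sum_congr rfl fun ξ _ => ?_
      split_ifs <;> simp [configLaw]
    · intro ξ _
      split_ifs
      · exact PMF.apply_ne_top _ _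
      · simp
  simp_rw [h, Finset.sum_mul]
  rw [Finset.sum_comm]
  refine Finset.sum_congr rfl fun ξ _ => ?_
  simp [ite_mul, configWeight_toReal]

/-- Independence of the edges, in the form in which it is used: the expectation of a product over
pairs factorizes. -/
lemma sum_config_prod {ι : Type*} [Fintype ι] [DecidableEq ι] (q : ι → ℝ) (F : ι → Bool → ℝ) :
    ∑ ξ : ι → Bool, (∏ p, (if ξ p then q p else 1 - q p)) * ∏ p, F p (ξ p) =
      ∏ p, (q p * F p true + (1 - q p) * F p false) := by
  have h := (Finset.prod_univ_sum (fun _ : ι => (Finset.univ : Finset Bool))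
    (fun p c => (if c then q p else 1 - q p) * F p c)).symm
  rw [Fintype.piFinset_univ] at h
  simp_rw [← Finset.prod_mul_distrib]
  rw [h]
  simp

lemma adj_symm {n : ℕ} (G : SimpleGraph (Fin n)) (u v : Fin n) : adj G u v = adj G v u := by
  classical
  simp [adj, SimpleGraph.adjMatrix_apply, G.adj_comm]

lemma adj_self {n : ℕ} (G : SimpleGraph (Fin n)) (u : Fin n) : adj G u u = 0 := by
  classical
  simp [adj, SimpleGraph.adjMatrix_apply]

lemma adj_graphOf_pair {n : ℕ} (ξ : Pairs n → Bool) (p : Pairs n) :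
    adj (graphOf ξ) p.1.1 p.1.2 = if ξ p then 1 else 0 := by
  classical
  obtain ⟨⟨i, j⟩, h⟩ := p
  have h' : i < j := h
  rw [adj, SimpleGraph.adjMatrix_apply]
  simp [graphOf, h', h'.ne, h'.not_gt]

lemma adj_graphOf {n : ℕ} (ξ : Pairs n → Bool) (p : Pairs n) {u v : Fin n}
    (h : s(p.1.1, p.1.2) = s(u, v)) : adj (graphOf ξ) u v = if ξ p then 1 else 0 := by
  rcases Sym2.eq_iff.1 h with ⟨rfl, rfl⟩ | ⟨rfl, rfl⟩
  · exact adj_graphOf_pair ξ p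
  · rw [adj_symm]; exact adj_graphOf_pair ξ p

lemma exists_pair {n : ℕ} {u v : Fin n} (h : u ≠ v) : ∃ p : Pairs n, s(p.1.1, p.1.2) = s(u, v) := by
  rcases lt_or_gt_of_ne h with h | h
  · exact ⟨⟨(u, v), h⟩, rfl⟩
  · exact ⟨⟨(v, u), h⟩, Sym2.eq_swap⟩

lemma pair_injective (n : ℕ) : Function.Injective fun p : Pairs n => s(p.1.1, p.1.2) := by
  rintro ⟨⟨i, j⟩, h⟩ ⟨⟨k, l⟩, h'⟩ e
  rcases Sym2.eq_iff.1 e with ⟨rfl, rfl⟩ | ⟨rfl, rfl⟩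
  · rfl
  · exact absurd h (not_lt.2 (le_of_lt h'))

lemma meanAdj_apply (a b : ℝ) (n : ℕ) (s : Fin n → ℤˣ) (u v : Fin n) :
    meanAdj a b n s u v = if u = v then 0 else edgePr a b n (s u) (s v) := by
  classical
  have h : meanAdj a b n s u v = ∑ G, (graphLaw a b n s G).toReal * adj G u v := by
    simp [meanAdj, Matrix.sum_apply]
  rw [h]
  split_ifs with huv
  · subst huv; simp [adj_self]
  obtain ⟨p, hp⟩ := exists_pair huv
  rw [sum_graphLaw_mul]
  -- A single entry is written as a product over all pairs, trivial away from `p`, so that the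
  -- factorization applies.
  have h2 : ∀ ξ : Pairs n → Bool, adj (graphOf ξ) u v =
      ∏ q : Pairs n, (fun q c => if q = p then (if c = true then (1 : ℝ) else 0) else 1) q (ξ q) := by
    intro ξ
    rw [adj_graphOf ξ p hp]
    simp
  simp_rw [h2]
  rw [sum_config_prod (fun p : Pairs n => edgePr a b n (s p.1.1) (s p.1.2))
    (fun q c => if q = p then (if c = true then (1 : ℝ) else 0) else 1)]
  rw [Finset.prod_eq_single p]
  · rcases Sym2.eq_iff.1 hp with ⟨h1, h2⟩ | ⟨h1, h2⟩
    · simp [h1, h2]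
    · simp [h1, h2, edgePr_comm]
  · intro q _ hq
    simp [hq]
  · simp

lemma meanAdj_formula {a b : ℝ} (ha : 0 ≤ a) (hb : 0 ≤ b) (n : ℕ) (s : Fin n → ℤˣ)
    (hn : max a b ≤ n) :
    meanAdj a b n s =
        (a / n) • ((1 / 2 : ℝ) • (Matrix.of (fun _ _ => 1) +
            Matrix.vecMulVec (fun i => spinVal (s i)) (fun i => spinVal (s i))) - 1) +
          (b / (2 * n)) • (Matrix.of (fun _ _ => 1) -
            Matrix.vecMulVec (fun i => spinVal (s i)) (fun i => spinVal (s i))) := by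
  ext u v
  rw [meanAdj_apply]
  simp only [Matrix.add_apply, Matrix.smul_apply, Matrix.sub_apply, Matrix.of_apply,
    Matrix.vecMulVec_apply, smul_eq_mul, Matrix.one_apply]
  have hn0 : (n : ℝ) ≠ 0 := by
    have := u.pos
    positivity
  split_ifs with huv
  · subst huv
    rcases Int.units_eq_one_or (s u) with h | h <;> simp [h, spinVal] <;> norm_num
  · rw [edgePr_eq ha hb hn]
    rcases Int.units_eq_one_or (s u) with h | h <;>
      rcases Int.units_eq_one_or (s v) with h' | h' <;>
      simp [h, h', spinVal] <;> field_simp <;> norm_num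

/-! ### Encoding a walk by symbols, and the weighted count of walks. -/

section Exploration

variable {V : Type*} [DecidableEq V]

/-- The first time at which the sequence `W` visits the node `W t`. -/
def firstTime (W : ℕ → V) (t : ℕ) : ℕ := Nat.find (⟨t, rfl⟩ : ∃ r, W r = W t)

lemma apply_firstTime (W : ℕ → V) (t : ℕ) : W (firstTime W t) = W t :=
  Nat.find_spec (⟨t, rfl⟩ : ∃ r, W r = W t)

lemma firstTime_le_of_eq {W : ℕ → V} {r t : ℕ} (h : W r = W t) : firstTime W t ≤ r :=
  Nat.find_min' _ h

lemma firstTime_le (W : ℕ → V) (t : ℕ) : firstTime W t ≤ t := firstTime_le_of_eq rfl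

lemma firstTime_congr {W : ℕ → V} {r t : ℕ} (h : W r = W t) : firstTime W r = firstTime W t :=
  le_antisymm (firstTime_le_of_eq ((apply_firstTime W t).trans h.symm))
    (firstTime_le_of_eq ((apply_firstTime W r).trans h))

lemma firstTime_firstTime (W : ℕ → V) (t : ℕ) : firstTime W (firstTime W t) = firstTime W t :=
  firstTime_congr (apply_firstTime W t)

lemma firstTime_eq_of_agree {W W' : ℕ → V} {t : ℕ} (h : ∀ r ≤ t, W r = W' r) :
    ∀ r ≤ t, firstTime W r = firstTime W' r := by
  intro r hr
  apply le_antisymm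
  · apply firstTime_le_of_eq
    exact (h _ ((firstTime_le W' r).trans hr)).trans ((apply_firstTime W' r).trans (h r hr).symm)
  · apply firstTime_le_of_eq
    exact (h _ ((firstTime_le W r).trans hr)).symm.trans ((apply_firstTime W r).trans (h r hr))

/-- Step `t` goes to a known node along the edge by which that node was discovered. -/
def IsDown (W : ℕ → V) (t : ℕ) : Prop :=
  firstTime W (t + 1) ≤ t ∧ 0 < firstTime W (t + 1) ∧ W (firstTime W (t + 1) - 1) = W t

/-- Step `t` goes back along the edge by which the current node was discovered. -/
def IsUp (W : ℕ → V) (t : ℕ) : Prop :=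
  firstTime W (t + 1) ≤ t ∧ 0 < firstTime W t ∧ W (t + 1) = W (firstTime W t - 1)

lemma exists_runEnd (W : ℕ → V) (L t : ℕ) : ∃ r, t + 1 ≤ r ∧ (L ≤ r ∨ ¬ IsDown W r) :=
  ⟨max (t + 1) L, le_max_left _ _, Or.inl (le_max_right _ _)⟩

open Classical in
/-- The end of the run of downward steps which contains step `t`. -/
def runEnd (W : ℕ → V) (L t : ℕ) : ℕ := Nat.find (exists_runEnd W L t)

lemma runEnd_eq_succ {W : ℕ → V} {L t : ℕ} (h : L ≤ t + 1 ∨ ¬ IsDown W (t + 1)) :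
    runEnd W L t = t + 1 := by
  classical
  exact le_antisymm (Nat.find_min' _ ⟨le_rfl, h⟩) (Nat.find_spec (exists_runEnd W L t)).1

lemma runEnd_succ {W : ℕ → V} {L t : ℕ} (hL : t + 1 < L) (h : IsDown W (t + 1)) :
    runEnd W L t = runEnd W L (t + 1) := by
  classical
  have h1 := Nat.find_spec (exists_runEnd W L t)
  have h2 := Nat.find_spec (exists_runEnd W L (t + 1))
  apply le_antisymm
  · exact Nat.find_min' _ ⟨(Nat.le_succ _).trans h2.1, h2.2⟩
  · refine Nat.find_min' _ ⟨?_, h1.2⟩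
    rcases h1.1.lt_or_eq with h3 | h3
    · exact h3
    · exfalso
      rw [← h3] at h1
      rcases h1.2 with h4 | h4
      · omega
      · exact h4 h

open Classical in
/-- The symbol of step `t`: `1` for the discovery of a node, `2` for an upward step, an odd number
encoding the end of the run for a downward step, an even number encoding the target otherwise. -/
def stepSym (W : ℕ → V) (L t : ℕ) : ℕ :=
  if firstTime W (t + 1) = t + 1 then 1
  else if IsDown W t then 3 + 2 * firstTime W (runEnd W L t)
  else if IsUp W t then 2
  else 4 + 2 * firstTime W (t + 1)

lemma stepSym_cases (W : ℕ → V) (L t : ℕ) :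
    (firstTime W (t + 1) = t + 1 ∧ stepSym W L t = 1) ∨
    (IsDown W t ∧ stepSym W L t = 3 + 2 * firstTime W (runEnd W L t)) ∨
    (IsUp W t ∧ stepSym W L t = 2) ∨
    (firstTime W (t + 1) ≤ t ∧ ¬ IsDown W t ∧ ¬ IsUp W t ∧
      stepSym W L t = 4 + 2 * firstTime W (t + 1)) := by
  unfold stepSym
  have := firstTime_le W (t + 1)
  by_cases h1 : firstTime W (t + 1) = t + 1
  · simp [h1]
  · by_cases h2 : IsDown W t
    · simp [h1, h2]
    · by_cases h3 : IsUp W t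
      · simp [h1, h2, h3]
      · simp only [h1, h2, h3, if_false]
        right; right; right
        simp only [not_false_eq_true, and_true]
        omega

/-- The first time at which the node preceding the node `W τ` was visited. -/
def parentTime (W : ℕ → V) (τ : ℕ) : ℕ := firstTime W (τ - 1)

lemma parentTime_le (W : ℕ → V) (τ : ℕ) : parentTime W τ ≤ τ - 1 := firstTime_le W (τ - 1)

lemma iterate_parentTime_le (W : ℕ → V) (i τ : ℕ) : (parentTime W)^[i] τ ≤ τ := by
  induction i generalizing τ with
  | zero => simp
  | succ i ih =>
    rw [Function.iterate_succ_apply]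
    exact (ih _).trans ((parentTime_le W τ).trans (Nat.sub_le _ _))

lemma iterate_parentTime_eq_of_agree {W W' : ℕ → V} {t : ℕ} (h : ∀ r ≤ t, W r = W' r) (i : ℕ) :
    ∀ θ ≤ t, (parentTime W)^[i] θ = (parentTime W')^[i] θ := by
  induction i with
  | zero => simp
  | succ i ih =>
    intro θ hθ
    rw [Function.iterate_succ_apply, Function.iterate_succ_apply,
      ih _ ((parentTime_le W θ).trans (by omega))]
    congr 1
    exact firstTime_eq_of_agree h _ (by omega)

/-- Parent times strictly decrease from positive times. For `i < j` the `j`-th ancestor is at most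
the parent of the `i`-th one; if the two parents agreed, a positive time would be at most its own
parent time. Thus a node has at most one child on a given line of ancestors. -/
lemma not_lt_of_parentTime_eq {W : ℕ → V} {θ i j : ℕ}
    (h0 : 0 < (parentTime W)^[j] θ)
    (h : parentTime W ((parentTime W)^[i] θ) = parentTime W ((parentTime W)^[j] θ)) :
    ¬ i < j := by
  intro hij
  obtain ⟨k, rfl⟩ := Nat.exists_eq_add_of_lt hij
  have h1 : (parentTime W)^[i + k + 1] θ =
      (parentTime W)^[k] (parentTime W ((parentTime W)^[i] θ)) := by
    rw [← Function.iterate_succ_apply, ← Function.iterate_add_apply]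
    congr 1; omega
  have h2 := iterate_parentTime_le W k (parentTime W ((parentTime W)^[i] θ))
  rw [← h1, h] at h2
  have h3 := parentTime_le W ((parentTime W)^[i + k + 1] θ)
  omega

/-- Each step of a downward run goes from a parent to its child, so climbing from the end of the run
passes through all the nodes of the run. The first part bounds the symbol and makes it readable from
the past. The induction is on the number of steps left. -/
lemma iterate_parentTime_runEnd {W : ℕ → V} {L : ℕ} (m : ℕ) : ∀ t, L = t + m + 1 → IsDown W t →
    firstTime W (runEnd W L t) ≤ t ∧
      ∃ i, (parentTime W)^[i] (firstTime W (runEnd W L t)) = firstTime W (t + 1) := by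
  have base : ∀ t, IsDown W t → runEnd W L t = t + 1 →
      firstTime W (runEnd W L t) ≤ t ∧
      ∃ i, (parentTime W)^[i] (firstTime W (runEnd W L t)) = firstTime W (t + 1) := by
    intro t h h1
    rw [h1]
    exact ⟨h.1, 0, rfl⟩
  induction m with
  | zero =>
    intro t hL h
    exact base t h (runEnd_eq_succ (Or.inl (by omega)))
  | succ m ih =>
    intro t hL h
    by_cases h' : IsDown W (t + 1)
    · obtain ⟨h1, i, h2⟩ := ih (t + 1) (by omega) h'
      rw [runEnd_succ (by omega) h']
      refine ⟨?_, i + 1, ?_⟩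
      -- If the end of the run were first visited at time `t + 1`, then `W (t + 1)` would be new,
      -- whereas the downward step `t` leads to a known node.
      · rcases h1.lt_or_eq with h3 | h3
        · omega
        · have h4 := firstTime_firstTime W (runEnd W L (t + 1))
          rw [h3] at h4
          have := h.1
          omega
      · rw [Function.iterate_succ_apply', h2]
        exact firstTime_congr h'.2.2
    · exact base t h (runEnd_eq_succ (Or.inr h'))

/-- Decoding one step. The value and parity of the symbol give the type of the step. An upward step
is determined by the past, and a step to an old node carries its target. For a downward step the
symbol gives the end of the run, and the target is the only ancestor of it whose parent is the
current node. Only a discovery leaves the node free. -/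
lemma apply_succ_eq_of_stepSym_eq {W W' : ℕ → V} {L t : ℕ} (hL : t < L)
    (h : ∀ r ≤ t, W r = W' r) (hs : stepSym W L t = stepSym W' L t) (h1 : stepSym W L t ≠ 1) :
    W (t + 1) = W' (t + 1) := by
  rcases stepSym_cases W L t with ⟨a1, a2⟩ | ⟨a1, a2⟩ | ⟨a1, a2⟩ | ⟨a1, a2, a3, a4⟩ <;>
  rcases stepSym_cases W' L t with ⟨b1, b2⟩ | ⟨b1, b2⟩ | ⟨b1, b2⟩ | ⟨b1, b2, b3, b4⟩ <;>
  try omega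
  · obtain ⟨c1, i, c2⟩ := iterate_parentTime_runEnd (W := W) (L := L) (L - t - 1) t (by omega) a1
    obtain ⟨d1, j, d2⟩ := iterate_parentTime_runEnd (W := W') (L := L) (L - t - 1) t (by omega) b1
    have e : firstTime W' (runEnd W' L t) = firstTime W (runEnd W L t) := by omega
    rw [e] at d1 d2
    rw [← iterate_parentTime_eq_of_agree h j _ c1] at d2
    have p1 : parentTime W (firstTime W (t + 1)) = firstTime W t := firstTime_congr a1.2.2
    have p2 : parentTime W (firstTime W' (t + 1)) = firstTime W t := by
      refine firstTime_congr ?_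
      rw [h _ (by have := b1.1; omega), h t le_rfl]
      exact b1.2.2
    -- Both targets are ancestors of the same node, and the current node is the parent of both.
    have hij : i = j := by
      apply le_antisymm
      · rw [← not_lt]
        apply not_lt_of_parentTime_eq (W := W) (θ := firstTime W (runEnd W L t))
        · rw [c2]; exact a1.2.1
        · rw [c2, d2, p1, p2]
      · rw [← not_lt]
        apply not_lt_of_parentTime_eq (W := W) (θ := firstTime W (runEnd W L t))
        · rw [d2]; exact b1.2.1
        · rw [c2, d2, p1, p2]
    have e2 : firstTime W (t + 1) = firstTime W' (t + 1) := by rw [← c2, ← d2, hij]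
    rw [← apply_firstTime W, ← apply_firstTime W', ← e2]
    exact h _ a1.1
  · rw [a1.2.2, b1.2.2, firstTime_eq_of_agree h t le_rfl]
    exact h _ (by have := firstTime_le W' t; omega)
  · have e2 : firstTime W (t + 1) = firstTime W' (t + 1) := by omega
    rw [← apply_firstTime W, ← apply_firstTime W', ← e2]
    exact h _ a1

/-- The symbol of step `t`, replaced by `0` if it repeats the previous one. -/
def stepCode (W : ℕ → V) (L t : ℕ) : ℕ :=
  if 0 < t ∧ stepSym W L t = stepSym W L (t - 1) then 0 else stepSym W L t

lemma stepSym_pos (W : ℕ → V) (L t : ℕ) : 0 < stepSym W L t := by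
  rcases stepSym_cases W L t with h | h | h | ⟨_, _, _, h⟩ <;> omega

lemma stepSym_le {W : ℕ → V} {L t : ℕ} (h : t < L) : stepSym W L t ≤ 2 * L + 2 := by
  rcases stepSym_cases W L t with h | h | h | ⟨h1, _, _, h⟩
  · omega
  · have := (iterate_parentTime_runEnd (W := W) (L := L) (L - t - 1) t (by omega) h.1).1
    omega
  · omega
  · omega

lemma stepCode_le {W : ℕ → V} {L t : ℕ} (h : t < L) : stepCode W L t ≤ 2 * L + 2 := by
  unfold stepCode
  split_ifs
  · omega
  · exact stepSym_le h

lemma stepSym_eq_of_stepCode_eq {W W' : ℕ → V} {L : ℕ}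
    (h : ∀ t < L, stepCode W L t = stepCode W' L t) :
    ∀ t < L, stepSym W L t = stepSym W' L t := by
  intro t
  induction t with
  | zero => intro ht; simpa [stepCode] using h 0 ht
  | succ t ih =>
    intro ht
    have h1 := h (t + 1) ht
    have h2 := ih (by omega)
    have h3 := stepSym_pos W L (t + 1)
    have h4 := stepSym_pos W' L (t + 1)
    simp only [stepCode, Nat.add_sub_cancel, Nat.succ_pos, true_and] at h1
    split_ifs at h1 <;> omega

/-- The steps which discover a node. -/
def newSteps (W : ℕ → V) (L : ℕ) : Finset ℕ := {t ∈ Finset.range L | stepSym W L t = 1}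

lemma stepSym_eq_one_iff {W : ℕ → V} {L t : ℕ} :
    stepSym W L t = 1 ↔ firstTime W (t + 1) = t + 1 := by
  constructor
  · intro h
    rcases stepSym_cases W L t with h' | h' | h' | ⟨_, _, _, h'⟩ <;> omega
  · intro h; simp [stepSym, h]

/-- Nodes correspond to their first visits: time `0`, and the times just after a discovery. -/
lemma card_image_eq_card_newSteps (W : ℕ → V) (L : ℕ) :
    ((Finset.range (L + 1)).image W).card = (newSteps W L).card + 1 := by
  have h0 : (insert 0 ((newSteps W L).image Nat.succ)).card = (newSteps W L).card + 1 := by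
    rw [Finset.card_insert_of_notMem, Finset.card_image_of_injective _ Nat.succ_injective]
    simp
  rw [← h0]
  have hmem : ∀ t, t ∈ insert 0 ((newSteps W L).image Nat.succ) ↔ t ≤ L ∧ firstTime W t = t := by
    intro t
    rcases t with _ | t
    · simpa using firstTime_le W 0
    · simp [newSteps, stepSym_eq_one_iff]
  symm
  apply Finset.card_nbij W
  · intro t ht
    have := (hmem t).1 ht
    exact Finset.mem_image_of_mem _ (Finset.mem_range.2 (by omega))
  · intro t ht r hr htr
    have h1 := (hmem t).1 ht
    have h2 := (hmem r).1 hr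
    rw [← h1.2, ← h2.2]
    exact firstTime_congr htr
  · intro x hx
    obtain ⟨t, ht, rfl⟩ := Finset.mem_image.1 hx
    refine ⟨firstTime W t, ?_, apply_firstTime W t⟩
    refine (hmem _).2 ⟨?_, firstTime_firstTime W t⟩
    have := Finset.mem_range.1 ht
    have := firstTime_le W t
    omega

lemma eq_of_stepCode_eq {W W' : ℕ → V} {L : ℕ}
    (h : ∀ t < L, stepCode W L t = stepCode W' L t) (h0 : W 0 = W' 0)
    (hnew : ∀ t ∈ newSteps W L, W (t + 1) = W' (t + 1)) : ∀ t ≤ L, W t = W' t := by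
  intro t
  induction t using Nat.strong_induction_on with
  | _ t ih =>
    intro ht
    rcases t with _ | t
    · exact h0
    · by_cases h1 : stepSym W L t = 1
      · exact hnew t (by simp only [newSteps, Finset.mem_filter, Finset.mem_range]; omega)
      · exact apply_succ_eq_of_stepSym_eq (by omega) (fun r hr => ih r (by omega) (by omega))
          (stepSym_eq_of_stepCode_eq h t (by omega)) h1

/-- The code fixes the times of discovery, and the walk is recovered from its code and its values at
time `0` and at these times. Hence the number of walks with a given code is at most the inverse of
their common factor in `Fintype.card V`. The remaining sum over codes is a product over steps: one
zero symbol of weight `1`, and `2 * L + 2` others of weight `z`. -/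
lemma sum_weight_stepCode_le {ι : Type*} [Fintype ι] [Fintype V] (W : ι → ℕ → V) (L : ℕ)
    (hW : ∀ i j, (∀ t ≤ L, W i t = W j t) → i = j) {z : ℝ} (hz : 0 ≤ z) :
    ∑ i, ((Fintype.card V : ℝ)⁻¹) ^ ((Finset.range (L + 1)).image (W i)).card *
      z ^ ({t ∈ Finset.range L | stepCode (W i) L t ≠ 0}).card ≤ (1 + (2 * L + 2) * z) ^ L := by
  classical
  let c : ι → Fin L → Fin (2 * L + 3) := fun i t =>
    ⟨stepCode (W i) L t, by have := stepCode_le (W := W i) t.2; omega⟩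
  have hc : ∀ i j, c i = c j → ∀ t < L, stepCode (W i) L t = stepCode (W j) L t := by
    intro i j hij t ht
    have := congrFun hij ⟨t, ht⟩
    simpa [c] using this
  have hz' : ∀ i, z ^ ({t ∈ Finset.range L | stepCode (W i) L t ≠ 0}).card =
      ∏ t : Fin L, (if c i t = 0 then 1 else z) := by
    intro i
    rw [← Finset.prod_const, Finset.prod_filter, Finset.prod_range]
    refine Finset.prod_congr rfl fun t _ => ?_
    simp only [c, Fin.ext_iff, Fin.val_zero]
    by_cases h : stepCode (W i) L t = 0 <;> simp [h]
  have hprod : ∑ d : Fin L → Fin (2 * L + 3), ∏ t : Fin L, (if d t = 0 then 1 else z) =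
      (1 + (2 * L + 2) * z) ^ L := by
    have h := (Finset.prod_univ_sum (fun _ : Fin L => (Finset.univ : Finset (Fin (2 * L + 3))))
      (fun _ x => if x = 0 then 1 else z))
    rw [Fintype.piFinset_univ] at h
    rw [← h]
    simp only [Finset.prod_const, Finset.card_univ, Fintype.card_fin]
    congr 1
    rw [Fin.sum_univ_succ]
    simp
  rw [← hprod, ← Finset.sum_fiberwise Finset.univ c]
  refine Finset.sum_le_sum fun d _ => ?_
  set P := ∏ t : Fin L, (if d t = 0 then 1 else z) with hP
  have hP0 : 0 ≤ P := Finset.prod_nonneg fun t _ => by split_ifs <;> positivity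
  by_cases hne : ∃ i0, c i0 = d
  · obtain ⟨i0, rfl⟩ := hne
    set S := insert 0 ((newSteps (W i0) L).image Nat.succ) with hS
    have hScard : S.card = ((Finset.range (L + 1)).image (W i0)).card := by
      rw [card_image_eq_card_newSteps, hS, Finset.card_insert_of_notMem,
        Finset.card_image_of_injective _ Nat.succ_injective]
      simp
    have hnew : ∀ i, c i = c i0 → newSteps (W i) L = newSteps (W i0) L := by
      intro i hi
      refine Finset.filter_congr fun t ht => ?_
      rw [stepSym_eq_of_stepCode_eq (hc i i0 hi) t (Finset.mem_range.1 ht)]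
    have hfib : ({i : ι | c i = c i0} : Finset ι).card ≤ Fintype.card V ^ S.card := by
      have : Fintype.card (S → V) = Fintype.card V ^ S.card := by simp
      rw [← this, ← Finset.card_univ]
      apply Finset.card_le_card_of_injOn (fun i (t : S) => W i t) (fun _ _ => Finset.mem_univ _)
      intro i hi j hj hij
      have hi' : c i = c i0 := by simpa using hi
      have hj' : c j = c i0 := by simpa using hj
      apply hW
      apply eq_of_stepCode_eq (hc i j (hi'.trans hj'.symm))
      · exact congrFun hij ⟨0, by simp [hS]⟩
      · intro t ht
        rw [hnew i hi'] at ht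
        exact congrFun hij ⟨t + 1, by simp [hS, ht]⟩
    have hV : 0 < (Fintype.card V : ℝ) := by
      have : Nonempty V := ⟨W i0 0⟩
      exact_mod_cast Fintype.card_pos
    calc _ = ∑ i : ι with c i = c i0, ((Fintype.card V : ℝ)⁻¹) ^ S.card * P := by
          refine Finset.sum_congr rfl fun i hi => ?_
          have hi' : c i = c i0 := by simpa using hi
          rw [hz' i, hi', hScard, card_image_eq_card_newSteps, card_image_eq_card_newSteps,
            hnew i hi']
      _ = (({i : ι | c i = c i0} : Finset ι).card : ℝ) *
            (((Fintype.card V : ℝ)⁻¹) ^ S.card * P) := by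
          rw [Finset.sum_const, nsmul_eq_mul]
      _ ≤ (Fintype.card V : ℝ) ^ S.card * (((Fintype.card V : ℝ)⁻¹) ^ S.card * P) := by
          gcongr
          exact_mod_cast hfib
      _ = P := by
          rw [← mul_assoc, ← mul_pow, mul_inv_cancel₀ hV.ne', one_pow, one_mul]
  · rw [Finset.sum_eq_zero]
    · exact hP0
    · intro i hi
      exact absurd ⟨i, by simpa using hi⟩ hne

end Exploration

/-! ### The number of symbol changes is controlled by the number of excess edges. -/

section Changes

variable {V : Type*} [DecidableEq V]

/-- The edges used by the steps of `W` which are not in `J`. -/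
def walkEdges (W : ℕ → V) (L : ℕ) (J : Finset ℕ) : Finset (Sym2 V) :=
  (Finset.range L \ J).image fun t => s(W t, W (t + 1))

/-- The steps to a known node along an edge by which no node was discovered. -/
def oldSteps (W : ℕ → V) (L : ℕ) : Finset ℕ :=
  {t ∈ Finset.range L | 4 ≤ stepSym W L t ∧ Even (stepSym W L t)}

lemma oldSteps_spec {W : ℕ → V} {L t : ℕ} (h : t ∈ oldSteps W L) :
    firstTime W (t + 1) ≤ t ∧ ¬ IsDown W t ∧ ¬ IsUp W t := by
  simp only [oldSteps, Finset.mem_filter, Nat.even_iff] at h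
  rcases stepSym_cases W L t with h' | h' | h' | h'
  · omega
  · omega
  · omega
  · exact ⟨h'.1, h'.2.1, h'.2.2.1⟩

/-- Outside `J`, distinct discoveries use distinct edges, and a step to an old node never uses a
discovery edge, as it would otherwise be downward or upward. The remaining edges carry at most `μ`
old steps each. -/
lemma mul_card_newSteps_add_le (W : ℕ → V) (L : ℕ) (J : Finset ℕ) (μ : ℕ)
    (hμ : ∀ e : Sym2 V, ({t ∈ Finset.range L \ J | s(W t, W (t + 1)) = e}).card ≤ μ) :
    μ * (newSteps W L).card + (oldSteps W L).card ≤
      μ * ((walkEdges W L J).card + J.card) + J.card := by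
  set f : ℕ → Sym2 V := fun t => s(W t, W (t + 1)) with hf
  set EN := (newSteps W L \ J).image f with hEN
  set EX := (oldSteps W L \ J).image f with hEX
  have hnew : ∀ t ∈ newSteps W L \ J, firstTime W (t + 1) = t + 1 := by
    intro t ht
    simp only [newSteps, Finset.mem_sdiff, Finset.mem_filter, stepSym_eq_one_iff] at ht
    exact ht.1.2
  have hcN : EN.card = (newSteps W L \ J).card := by
    apply Finset.card_image_of_injOn
    have key : ∀ t r, firstTime W (r + 1) = r + 1 → t < r → f t ≠ f r := by
      intro t r hr htr he
      rcases Sym2.eq_iff.1 he with ⟨_, h⟩ | ⟨h, _⟩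
      · have := firstTime_le_of_eq h; omega
      · have := firstTime_le_of_eq h; omega
    intro t ht r hr htr
    rcases lt_trichotomy t r with h | h | h
    · exact absurd htr (key t r (hnew r hr) h)
    · exact h
    · exact absurd htr.symm (key r t (hnew t ht) h)
  have hdisj : Disjoint EN EX := by
    rw [Finset.disjoint_left]
    intro e heN heX
    obtain ⟨r, hr, rfl⟩ := Finset.mem_image.1 heN
    obtain ⟨t, ht, he⟩ := Finset.mem_image.1 heX
    have hr' := hnew r hr
    obtain ⟨h1, h2, h3⟩ := oldSteps_spec (Finset.mem_sdiff.1 ht).1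
    rcases Sym2.eq_iff.1 he with ⟨ha, hb⟩ | ⟨ha, hb⟩
    · have h4 : firstTime W (t + 1) = r + 1 := (firstTime_congr hb).trans hr'
      refine h2 ⟨h1, by omega, ?_⟩
      rw [h4, ha]; rfl
    · have h4 : firstTime W t = r + 1 := (firstTime_congr ha).trans hr'
      refine h3 ⟨h1, by omega, ?_⟩
      rw [h4, hb]; rfl
  have hsub : EN ∪ EX ⊆ walkEdges W L J := by
    apply Finset.union_subset
    · apply Finset.image_subset_image
      exact Finset.sdiff_subset_sdiff (Finset.filter_subset _ _) le_rfl
    · apply Finset.image_subset_image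
      exact Finset.sdiff_subset_sdiff (Finset.filter_subset _ _) le_rfl
  have h1 : EN.card + EX.card ≤ (walkEdges W L J).card := by
    rw [← Finset.card_union_of_disjoint hdisj]
    exact Finset.card_le_card hsub
  have h2 : (oldSteps W L \ J).card ≤ μ * EX.card := by
    apply Finset.card_le_mul_card_image
    intro e _
    refine le_trans (Finset.card_le_card ?_) (hμ e)
    apply Finset.filter_subset_filter
    exact Finset.sdiff_subset_sdiff (Finset.filter_subset _ _) le_rfl
  have h3 : (newSteps W L).card ≤ (newSteps W L \ J).card + J.card := by
    have := Finset.le_card_sdiff J (newSteps W L); omega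
  have h4 : (oldSteps W L).card ≤ (oldSteps W L \ J).card + J.card := by
    have := Finset.le_card_sdiff J (oldSteps W L); omega
  have h5 : μ * (newSteps W L).card + μ * EX.card ≤ μ * ((walkEdges W L J).card + J.card) := by
    rw [← mul_add]
    apply Nat.mul_le_mul_left
    omega
  omega

/-- The level of a symbol: between jumps and steps to old nodes, the levels of the successive steps
are nondecreasing. -/
def symLevel (x : ℕ) : ℕ := if x = 1 then 2 else if x % 2 = 1 then 1 else 0

lemma symLevel_le (x : ℕ) : symLevel x ≤ 2 := by
  unfold symLevel; split_ifs <;> omega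

/-- A walk that does not backtrack goes up, then down, then discovers. No known child hangs below a
node just discovered; going up right after a discovery or a downward step would backtrack; and two
successive downward steps belong to the same run, hence share their symbol. -/
lemma symLevel_lt_of_ne {W : ℕ → V} {L t : ℕ} (hL : t + 1 < L) (hW : W t ≠ W (t + 2))
    (h1 : t ∉ oldSteps W L) (h2 : t + 1 ∉ oldSteps W L)
    (hne : stepSym W L (t + 1) ≠ stepSym W L t) :
    symLevel (stepSym W L t) + 1 ≤ symLevel (stepSym W L (t + 1)) := by
  have g1 : ¬ (4 ≤ stepSym W L t ∧ Even (stepSym W L t)) := fun h =>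
    h1 (Finset.mem_filter.2 ⟨Finset.mem_range.2 (by omega), h⟩)
  have g2 : ¬ (4 ≤ stepSym W L (t + 1) ∧ Even (stepSym W L (t + 1))) := fun h =>
    h2 (Finset.mem_filter.2 ⟨Finset.mem_range.2 hL, h⟩)
  rw [Nat.even_iff] at g1 g2
  unfold symLevel
  rcases stepSym_cases W L t with ⟨a1, a2⟩ | ⟨a1, a2⟩ | ⟨a1, a2⟩ | ⟨a1, a2, a3, a4⟩ <;>
  rcases stepSym_cases W L (t + 1) with ⟨b1, b2⟩ | ⟨b1, b2⟩ | ⟨b1, b2⟩ | ⟨b1, b2, b3, b4⟩ <;>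
  try omega
  · exfalso
    have h3 := firstTime_le_of_eq b1.2.2
    have := b1.1
    have := b1.2.1
    omega
  · exfalso
    apply hW
    rw [b1.2.2, a1]
    rfl
  · rw [a2, b2]
    split_ifs <;> omega
  · exfalso
    rw [a2, b2, runEnd_succ hL b1] at hne
    exact hne rfl
  · exfalso
    apply hW
    rw [b1.2.2, a1.2.2]
  · rw [a2, b2]
    split_ifs <;> omega
  · rw [a2, b2, if_neg (by omega), if_neg (by omega), if_neg (by omega), if_pos (by omega)]

lemma card_stepCode_ne_zero_le (W : ℕ → V) (L : ℕ) (J : Finset ℕ)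
    (hJ : ∀ t, t + 1 < L → W t = W (t + 2) → t ∈ J ∨ t + 1 ∈ J) :
    ({t ∈ Finset.range L | stepCode W L t ≠ 0}).card ≤
      3 + 6 * J.card + 6 * (oldSteps W L).card := by
  set R : Finset ℕ := J ∪ oldSteps W L with hR
  set R' : Finset ℕ := R ∪ R.image Nat.succ with hR'
  -- Away from `R'` each change raises the level. A step in `R'` costs `3`: one possible change, and
  -- a fall of the level by at most `2`.
  have hind : ∀ T, T < L → ({t ∈ Finset.range (T + 1) | stepCode W L t ≠ 0}).card ≤
      1 + symLevel (stepSym W L T) + 3 * ({t ∈ Finset.range (T + 1) | t ∈ R'}).card := by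
    intro T
    induction T with
    | zero =>
      intro _
      have : ({t ∈ Finset.range (0 + 1) | stepCode W L t ≠ 0}).card ≤ 1 :=
        (Finset.card_filter_le _ _).trans (by simp)
      omega
    | succ T ih =>
      intro hT
      have h1 := ih (by omega)
      rw [Finset.range_add_one, Finset.filter_insert, Finset.filter_insert]
      have n1 : T + 1 ∉ ({t ∈ Finset.range (T + 1) | stepCode W L t ≠ 0} : Finset ℕ) := by simp
      have n2 : T + 1 ∉ ({t ∈ Finset.range (T + 1) | t ∈ R'} : Finset ℕ) := by simp
      have l1 := symLevel_le (stepSym W L T)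
      by_cases hr : T + 1 ∈ R'
      · rw [if_pos hr, Finset.card_insert_of_notMem n2]
        split_ifs
        · rw [Finset.card_insert_of_notMem n1]; omega
        · omega
      · rw [if_neg hr]
        by_cases he : stepSym W L (T + 1) = stepSym W L T
        · have : stepCode W L (T + 1) = 0 := by simp [stepCode, he]
          rw [if_neg (by simpa using this), he]
          exact h1
        · have hr1 : T + 1 ∉ R := fun h => hr (Finset.mem_union_left _ h)
          have hr2 : T ∉ R := fun h =>
            hr (Finset.mem_union_right _ (Finset.mem_image_of_mem Nat.succ h))
          simp only [hR, Finset.mem_union, not_or] at hr1 hr2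
          have hW : W T ≠ W (T + 2) := fun h => by
            rcases hJ T hT h with h | h
            · exact hr2.1 h
            · exact hr1.1 h
          have := symLevel_lt_of_ne hT hW hr2.2 hr1.2 he
          split_ifs
          · rw [Finset.card_insert_of_notMem n1]; omega
          · omega
  rcases Nat.eq_zero_or_pos L with h0 | h0
  · subst h0; simp
  · have h1 := hind (L - 1) (by omega)
    rw [Nat.sub_add_cancel h0] at h1
    have h2 := symLevel_le (stepSym W L (L - 1))
    have h3 : ({t ∈ Finset.range L | t ∈ R'}).card ≤ R'.card :=
      Finset.card_le_card fun t ht => (Finset.mem_filter.1 ht).2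
    have h4 : R'.card ≤ R.card + R.card :=
      (Finset.card_union_le _ _).trans (Nat.add_le_add_left Finset.card_image_le _)
    have h5 : R.card ≤ J.card + (oldSteps W L).card := Finset.card_union_le _ _
    omega

lemma card_stepCode_add_le (W : ℕ → V) (L : ℕ) (J : Finset ℕ) (μ : ℕ)
    (hJ : ∀ t, t + 1 < L → W t = W (t + 2) → t ∈ J ∨ t + 1 ∈ J)
    (hμ : ∀ e : Sym2 V, ({t ∈ Finset.range L \ J | s(W t, W (t + 1)) = e}).card ≤ μ) :
    ({t ∈ Finset.range L | stepCode W L t ≠ 0}).card +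
        6 * μ * (((Finset.range (L + 1)).image W).card - 1) ≤
      3 + 12 * J.card + 6 * μ * J.card + 6 * μ * (walkEdges W L J).card := by
  have h1 := card_stepCode_ne_zero_le W L J hJ
  have h2 := mul_card_newSteps_add_le W L J μ hμ
  rw [card_image_eq_card_newSteps, Nat.add_sub_cancel]
  nlinarith

end Changes

/-! ### Averaging over the spins along a spanning tree. -/

section SpinAverage

variable {V : Type*} [DecidableEq V]

/-- The trees with edge set `T` and node set `S`, grown by adding leaves. -/
inductive GrowTree : Finset V → Finset (Sym2 V) → Prop
  | single (v : V) : GrowTree {v} ∅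
  | grow {S : Finset V} {T : Finset (Sym2 V)} {u w : V} : GrowTree S T → u ∈ S → w ∉ S →
      GrowTree (insert w S) (insert s(u, w) T)

lemma GrowTree.mem_of_mem {S : Finset V} {T : Finset (Sym2 V)} (h : GrowTree S T) :
    ∀ e ∈ T, ∀ x ∈ e, x ∈ S := by
  induction h with
  | single v => simp
  | grow h hu hw ih =>
    intro e he x hx
    rcases Finset.mem_insert.1 he with rfl | he
    · rcases Sym2.mem_iff.1 hx with rfl | rfl
      · exact Finset.mem_insert_of_mem hu
      · exact Finset.mem_insert_self _ _
    · exact Finset.mem_insert_of_mem (ih e he x hx)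

lemma GrowTree.notMem_edge {S : Finset V} {T : Finset (Sym2 V)} (h : GrowTree S T) {u w : V}
    (hw : w ∉ S) : s(u, w) ∉ T :=
  fun he => hw (h.mem_of_mem _ he w (Sym2.mem_mk_right u w))

lemma GrowTree.card_eq {S : Finset V} {T : Finset (Sym2 V)} (h : GrowTree S T) :
    S.card = T.card + 1 := by
  induction h with
  | single v => simp
  | grow h hu hw ih =>
    rw [Finset.card_insert_of_notMem hw, Finset.card_insert_of_notMem (h.notMem_edge hw), ih]

/-- Connectivity is phrased through predicates that are constant along the edges. If no edge left
the tree grown so far, membership in it would be such a predicate, so the tree would already span.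
-/
lemma exists_growTree {S₀ : Finset V} {E : Finset (Sym2 V)} (hne : S₀.Nonempty)
    (hE : ∀ u v, s(u, v) ∈ E → u ∈ S₀)
    (hconn : ∀ f : V → Prop, (∀ u v, s(u, v) ∈ E → (f u ↔ f v)) →
      ∀ u ∈ S₀, ∀ v ∈ S₀, f u → f v) :
    ∃ T ⊆ E, GrowTree S₀ T := by
  have key : ∀ m, m + 1 ≤ S₀.card → ∃ S ⊆ S₀, ∃ T ⊆ E, GrowTree S T ∧ S.card = m + 1 := by
    intro m
    induction m with
    | zero =>
      intro _
      obtain ⟨v, hv⟩ := hne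
      exact ⟨{v}, by simpa using hv, ∅, by simp, GrowTree.single v, by simp⟩
    | succ m ih =>
      intro hm
      obtain ⟨S, hS, T, hT, hST, hc⟩ := ih (by omega)
      have hex : ∃ u w, s(u, w) ∈ E ∧ u ∈ S ∧ w ∉ S := by
        by_contra! hcon
        have h1 := hconn (· ∈ S) (fun u v huv => ⟨fun hu => hcon u v huv hu,
          fun hv => hcon v u (by rwa [Sym2.eq_swap]) hv⟩)
        obtain ⟨u, hu⟩ : S.Nonempty := Finset.card_pos.1 (by omega)
        have : S₀ ⊆ S := fun v hv => h1 u (hS hu) v hv hu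
        have := Finset.card_le_card this
        omega
      obtain ⟨u, w, huw, hu, hw⟩ := hex
      refine ⟨insert w S, ?_, insert s(u, w) T, ?_, hST.grow hu hw, ?_⟩
      · exact Finset.insert_subset (hE w u (by rwa [Sym2.eq_swap])) hS
      · exact Finset.insert_subset huw hT
      · rw [Finset.card_insert_of_notMem hw, hc]
  have hpos := Finset.card_pos.2 hne
  obtain ⟨S, hS, T, hT, hST, hc⟩ := key (S₀.card - 1) (by omega)
  have : S = S₀ := Finset.eq_of_subset_of_card_le hS (by omega)
  exact ⟨T, hT, this ▸ hST⟩

/-- The weight of an edge whose endpoints carry the spins `σ`. -/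
def spinWeight (g : ℤˣ → ℤˣ → ℝ) (hg : ∀ x y, g x y = g y x) (σ : V → ℤˣ) : Sym2 V → ℝ :=
  Sym2.lift ⟨fun u v => g (σ u) (σ v), fun _ _ => hg _ _⟩

omit [DecidableEq V] in
lemma spinWeight_mk (g : ℤˣ → ℤˣ → ℝ) (hg : ∀ x y, g x y = g y x) (σ : V → ℤˣ) (u v : V) :
    spinWeight g hg σ s(u, v) = g (σ u) (σ v) := rfl

/-- Flipping the spin of one node. -/
def flipSpin (w : V) : Equiv.Perm (V → ℤˣ) :=
  Function.Involutive.toPerm (fun σ => Function.update σ w (-σ w)) (by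
    intro σ
    simp)

lemma flipSpin_self (w : V) (σ : V → ℤˣ) : flipSpin w σ w = -σ w :=
  Function.update_self _ _ _

lemma flipSpin_of_ne {w u : V} (h : u ≠ w) (σ : V → ℤˣ) : flipSpin w σ u = σ u :=
  Function.update_of_ne h _ _

lemma spinWeight_flipSpin (g : ℤˣ → ℤˣ → ℝ) (hg : ∀ x y, g x y = g y x) (σ : V → ℤˣ) {w : V}
    (e : Sym2 V) (hw : w ∉ e) : spinWeight g hg (flipSpin w σ) e = spinWeight g hg σ e := by
  induction e using Sym2.ind with
  | _ u v =>
    simp only [Sym2.mem_iff, not_or] at hw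
    rw [spinWeight_mk, spinWeight_mk, flipSpin_of_ne (Ne.symm hw.1), flipSpin_of_ne (Ne.symm hw.2)]

variable [Fintype V]

/-- The spin of the last leaf occurs only in the weight of its own edge. Averaging that weight with
its value after a flip of this spin gives exactly `q`, whatever the other spins. -/
lemma GrowTree.sum_prod_spinWeight {S : Finset V} {T : Finset (Sym2 V)} (h : GrowTree S T)
    {g : ℤˣ → ℤˣ → ℝ} (hg : ∀ x y, g x y = g y x) {q : ℝ}
    (hq : ∀ x y, g x y + g x (-y) = 2 * q) :
    ∑ σ : V → ℤˣ, ∏ e ∈ T, spinWeight g hg σ e = 2 ^ Fintype.card V * q ^ T.card := by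
  induction h with
  | single v => simp
  | @grow S T u w h hu hw ih =>
    have hn := h.notMem_edge (u := u) hw
    have huw : u ≠ w := fun e => hw (e ▸ hu)
    simp_rw [Finset.prod_insert hn, spinWeight_mk]
    rw [Finset.card_insert_of_notMem hn, pow_succ, ← mul_assoc, ← ih]
    have h1 : ∑ σ : V → ℤˣ, g (σ u) (σ w) * ∏ e ∈ T, spinWeight g hg σ e =
        ∑ σ : V → ℤˣ, g (σ u) (-σ w) * ∏ e ∈ T, spinWeight g hg σ e := by
      rw [← Equiv.sum_comp (flipSpin w)]
      refine Finset.sum_congr rfl fun σ _ => ?_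
      rw [flipSpin_self, flipSpin_of_ne huw]
      congr 1
      refine Finset.prod_congr rfl fun e he => ?_
      exact spinWeight_flipSpin g hg σ e fun hwe => hw (h.mem_of_mem e he w hwe)
    have h2 : ∑ σ : V → ℤˣ, g (σ u) (σ w) * ∏ e ∈ T, spinWeight g hg σ e +
        ∑ σ : V → ℤˣ, g (σ u) (-σ w) * ∏ e ∈ T, spinWeight g hg σ e =
        2 * ((∑ σ : V → ℤˣ, ∏ e ∈ T, spinWeight g hg σ e) * q) := by
      rw [← Finset.sum_add_distrib, Finset.sum_mul, Finset.mul_sum]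
      refine Finset.sum_congr rfl fun σ _ => ?_
      rw [← add_mul, hq]
      ring
    linarith

/-- Only the edges of a spanning tree are averaged; the others are bounded by `r`. This is what
produces `α` rather than `max a b` in the final growth rate. -/
lemma sum_prod_spinWeight_le {S₀ : Finset V} {E : Finset (Sym2 V)} (hne : S₀.Nonempty)
    (hE : ∀ u v, s(u, v) ∈ E → u ∈ S₀)
    (hconn : ∀ f : V → Prop, (∀ u v, s(u, v) ∈ E → (f u ↔ f v)) →
      ∀ u ∈ S₀, ∀ v ∈ S₀, f u → f v)
    {g : ℤˣ → ℤˣ → ℝ} (hg : ∀ x y, g x y = g y x) {q r : ℝ}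
    (hq : ∀ x y, g x y + g x (-y) = 2 * q) (hg0 : ∀ x y, 0 ≤ g x y) (hgr : ∀ x y, g x y ≤ r) :
    S₀.card - 1 ≤ E.card ∧
    ∑ σ : V → ℤˣ, ∏ e ∈ E, spinWeight g hg σ e ≤
      2 ^ Fintype.card V * (q ^ (S₀.card - 1) * r ^ (E.card - (S₀.card - 1))) := by
  obtain ⟨T, hTE, hT⟩ := exists_growTree hne hE hconn
  have hcard : S₀.card - 1 = T.card := by have := hT.card_eq; omega
  rw [hcard]
  refine ⟨Finset.card_le_card hTE, ?_⟩
  have hw0 : ∀ (σ : V → ℤˣ) (e : Sym2 V), 0 ≤ spinWeight g hg σ e := by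
    intro σ e
    induction e using Sym2.ind with
    | _ u v => exact hg0 _ _
  have hwr : ∀ (σ : V → ℤˣ) (e : Sym2 V), spinWeight g hg σ e ≤ r := by
    intro σ e
    induction e using Sym2.ind with
    | _ u v => exact hgr _ _
  rw [← mul_assoc, ← hT.sum_prod_spinWeight hg hq, Finset.sum_mul]
  refine Finset.sum_le_sum fun σ _ => ?_
  rw [← Finset.prod_sdiff hTE, mul_comm]
  apply mul_le_mul_of_nonneg_left _ (Finset.prod_nonneg fun e _ => hw0 σ e)
  rw [← Finset.card_sdiff_of_subset hTE, ← Finset.prod_const]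
  exact Finset.prod_le_prod (fun e _ => hw0 σ e) fun e _ => hwr σ e

end SpinAverage

/-! ### Expectations over the edges, given the spins. -/

/-- The case of one edge of probability `x`, traversed by `r` centred and `m` uncentred steps. A
single centred step has mean zero. An uncentred step already forces the edge to be present, and so
counts as two in `r + 2 * m`. -/
lemma abs_edge_factor_le {x : ℝ} (h0 : 0 ≤ x) (h1 : x ≤ 1) (r m : ℕ) :
    |x * ((1 - x) ^ r * 1 ^ m) + (1 - x) * ((0 - x) ^ r * 0 ^ m)| ≤
      if r + 2 * m = 0 then 1 else if 2 ≤ r + 2 * m then x else 0 := by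
  rcases Nat.eq_zero_or_pos m with rfl | hm
  · rcases r with _ | _ | r
    · simp
    · have : x * (1 - x) + -((1 - x) * x) = 0 := by ring
      simp [this]
    · simp only [mul_one, pow_zero, mul_zero, add_zero, zero_sub]
      rw [if_neg (by omega), if_pos (by omega)]
      have e1 : (1 - x) ^ (r + 1) ≤ 1 - x :=
        pow_le_of_le_one (by linarith) (by linarith) (by omega)
      have e2 : x ^ (r + 1) ≤ x := pow_le_of_le_one h0 h1 (by omega)
      calc |x * (1 - x) ^ (r + 1 + 1) + (1 - x) * (-x) ^ (r + 1 + 1)|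
          ≤ |x * (1 - x) ^ (r + 1 + 1)| + |(1 - x) * (-x) ^ (r + 1 + 1)| := abs_add_le _ _
        _ = x * (1 - x) * ((1 - x) ^ (r + 1) + x ^ (r + 1)) := by
            rw [abs_mul, abs_mul, abs_pow, abs_pow, abs_neg, abs_of_nonneg h0,
              abs_of_nonneg (by linarith : 0 ≤ 1 - x)]
            ring
        _ ≤ x * (1 - x) * 1 := by
            apply mul_le_mul_of_nonneg_left (by linarith)
            exact mul_nonneg h0 (by linarith)
        _ ≤ x := by nlinarith
  · rw [if_neg (by omega), if_pos (by omega), zero_pow hm.ne']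
    simp only [one_pow, mul_one, mul_zero, add_zero]
    have : (1 - x) ^ r ≤ 1 := pow_le_one₀ (by linarith) (by linarith)
    have h3 : 0 ≤ (1 - x) ^ r := pow_nonneg (by linarith) _
    rw [abs_of_nonneg (mul_nonneg h0 h3)]
    nlinarith

/-- The probability of an edge, given the spins. -/
abbrev edgeWeight (a b : ℝ) (n : ℕ) (s : Fin n → ℤˣ) : Sym2 (Fin n) → ℝ :=
  spinWeight (edgePr a b n) (edgePr_comm a b n) s

lemma edgeWeight_nonneg (a b : ℝ) (n : ℕ) (s : Fin n → ℤˣ) (e : Sym2 (Fin n)) :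
    0 ≤ edgeWeight a b n s e := by
  induction e using Sym2.ind with
  | _ u v => exact edgePr_nonneg _ _ _ _ _

/-- By independence the expectation is a product over pairs. Either some edge met has count below
two and the product vanishes, or all have count at least two; summing the counts then gives the
constraint on the number of edges. -/
lemma abs_expectation_prod_le (a b : ℝ) (n : ℕ) (s : Fin n → ℤˣ) {ι : Type*} [Fintype ι]
    (u v : ι → Fin n) (huv : ∀ i, u i ≠ v i) (cen : ι → Prop) [DecidablePred cen] :
    |∑ G, (graphLaw a b n s G).toReal *
        ∏ i, (adj G (u i) (v i) - if cen i then meanAdj a b n s (u i) (v i) else 0)| ≤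
      if 2 * (Finset.univ.image fun i => s(u i, v i)).card ≤ ∑ i, (if cen i then 1 else 2)
      then ∏ e ∈ Finset.univ.image fun i => s(u i, v i), edgeWeight a b n s e else 0 := by
  classical
  choose f hf using fun i => exists_pair (huv i)
  set q : Pairs n → ℝ := fun p => edgePr a b n (s p.1.1) (s p.1.2) with hq
  have hmean : ∀ i, meanAdj a b n s (u i) (v i) = q (f i) := by
    intro i
    rw [meanAdj_apply, if_neg (huv i)]
    have : edgeWeight a b n s s(u i, v i) = edgeWeight a b n s s((f i).1.1, (f i).1.2) := by
      rw [hf i]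
    exact this
  set F : Pairs n → Bool → ℝ := fun p c =>
    ∏ i with f i = p, ((if c = true then 1 else 0) - if cen i then q p else 0) with hF
  have hprod : ∀ ξ : Pairs n → Bool,
      ∏ i, (adj (graphOf ξ) (u i) (v i) - if cen i then meanAdj a b n s (u i) (v i) else 0) =
        ∏ p, F p (ξ p) := by
    intro ξ
    rw [← Finset.prod_fiberwise Finset.univ f]
    refine Finset.prod_congr rfl fun p _ => Finset.prod_congr rfl fun i hi => ?_
    have hi' : f i = p := by simpa using hi
    rw [adj_graphOf ξ (f i) (hf i), hmean, hi']
  rw [sum_graphLaw_mul]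
  simp_rw [hprod]
  rw [sum_config_prod q F, Finset.abs_prod]
  set nc : Pairs n → ℕ := fun p => ({i | f i = p ∧ cen i} : Finset ι).card with hnc
  set np : Pairs n → ℕ := fun p => ({i | f i = p ∧ ¬ cen i} : Finset ι).card with hnp
  have hFv : ∀ p c, F p c = ((if c = true then 1 else 0) - q p) ^ nc p *
      (if c = true then 1 else 0) ^ np p := by
    intro p c
    simp only [hF, hnc, hnp]
    rw [← Finset.prod_filter_mul_prod_filter_not _ cen, Finset.filter_filter,
      Finset.filter_filter]
    congr 1
    · rw [← Finset.prod_const]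
      refine Finset.prod_congr rfl fun i hi => ?_
      rw [if_pos (Finset.mem_filter.1 hi).2.2]
    · rw [← Finset.prod_const]
      refine Finset.prod_congr rfl fun i hi => ?_
      rw [if_neg (c := cen i) (Finset.mem_filter.1 hi).2.2, sub_zero]
  have hbd : ∀ p, |q p * F p true + (1 - q p) * F p false| ≤
      if nc p + 2 * np p = 0 then 1 else if 2 ≤ nc p + 2 * np p then q p else 0 := by
    intro p
    rw [hFv, hFv]
    simpa using abs_edge_factor_le (edgePr_nonneg _ _ _ _ _) (edgePr_le_one _ _ _ _ _) (nc p) (np p)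
  have hsum : ∑ i, (if cen i then 1 else 2) = ∑ p, (nc p + 2 * np p) := by
    rw [← Finset.sum_fiberwise Finset.univ f]
    refine Finset.sum_congr rfl fun p _ => ?_
    simp only [hnc, hnp]
    rw [← Finset.sum_filter_add_sum_filter_not _ cen, Finset.filter_filter, Finset.filter_filter]
    congr 1
    · rw [Finset.card_eq_sum_ones]
      refine Finset.sum_congr rfl fun i hi => ?_
      rw [if_pos (Finset.mem_filter.1 hi).2.2]
    · rw [Finset.card_eq_sum_ones, Finset.mul_sum]
      refine Finset.sum_congr rfl fun i hi => ?_
      rw [if_neg (Finset.mem_filter.1 hi).2.2, mul_one]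
  have himg : (Finset.univ.image fun i => s(u i, v i)) =
      (Finset.univ.image f).image fun p : Pairs n => s(p.1.1, p.1.2) := by
    rw [Finset.image_image]
    refine Finset.image_congr fun i _ => ?_
    exact (hf i).symm
  rw [himg, Finset.card_image_of_injective _ (pair_injective n),
    Finset.prod_image fun p _ q _ h => pair_injective n h]
  have hpos : ∀ p, p ∈ Finset.univ.image f ↔ nc p + 2 * np p ≠ 0 := by
    intro p
    constructor
    · intro hp
      obtain ⟨i, _, rfl⟩ := Finset.mem_image.1 hp
      by_cases hi : cen i
      · have : 0 < nc (f i) := Finset.card_pos.2 ⟨i, by simp [hi]⟩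
        omega
      · have : 0 < np (f i) := Finset.card_pos.2 ⟨i, by simp [hi]⟩
        omega
    · intro hp
      have : 0 < nc p ∨ 0 < np p := by omega
      rcases this with h | h
      · obtain ⟨i, hi⟩ := Finset.card_pos.1 h
        exact Finset.mem_image.2 ⟨i, Finset.mem_univ _, (Finset.mem_filter.1 hi).2.1⟩
      · obtain ⟨i, hi⟩ := Finset.card_pos.1 h
        exact Finset.mem_image.2 ⟨i, Finset.mem_univ _, (Finset.mem_filter.1 hi).2.1⟩
  by_cases hall : ∀ p ∈ Finset.univ.image f, 2 ≤ nc p + 2 * np p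
  · rw [if_pos]
    · calc _ ≤ ∏ p, (if p ∈ Finset.univ.image f then q p else 1) := by
            refine Finset.prod_le_prod (fun p _ => abs_nonneg _) fun p _ => ?_
            refine (hbd p).trans ?_
            by_cases hp : p ∈ Finset.univ.image f
            · rw [if_neg ((hpos p).1 hp), if_pos (hall p hp), if_pos hp]
            · rw [if_pos (by simpa using mt (hpos p).2 hp), if_neg hp]
        _ = ∏ p ∈ Finset.univ.image f, q p := by
            rw [← Finset.prod_filter]; simp
        _ ≤ _ := le_of_eq rfl
    · rw [hsum]
      calc 2 * (Finset.univ.image f).card = ∑ p ∈ Finset.univ.image f, 2 := by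
            rw [Finset.sum_const, smul_eq_mul, mul_comm]
        _ ≤ ∑ p ∈ Finset.univ.image f, (nc p + 2 * np p) := Finset.sum_le_sum hall
        _ ≤ _ := Finset.sum_le_sum_of_subset (Finset.subset_univ _)
  · push Not at hall
    obtain ⟨p, hp, hlt⟩ := hall
    rw [Finset.prod_eq_zero (Finset.mem_univ p)]
    · split_ifs
      · exact Finset.prod_nonneg fun p _ => edgeWeight_nonneg _ _ _ _ _
      · exact le_rfl
    · have := hbd p
      rw [if_neg ((hpos p).1 hp), if_neg (by omega)] at this
      exact le_antisymm this (abs_nonneg _)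

/-! ### A common form for `Δ` and `Γ`, and the conditional expectation of a family of sequences. -/

section Blocks

variable {n : ℕ}

/-- The weight of the sequence `p`: its steps before the step `cut` are centred, the step `cut` is
averaged, and the later ones are not centred. -/
def blockWeight (a b : ℝ) (s : Fin n → ℤˣ) (G : SimpleGraph (Fin n)) (cut : ℕ) {ℓ : ℕ}
    (p : Fin (ℓ + 1) → Fin n) : ℝ :=
  ∏ t : Fin ℓ,
    (if (t : ℕ) < cut then adj G - meanAdj a b n s
      else if (t : ℕ) = cut then meanAdj a b n s
      else adj G) (p t.castSucc) (p t.succ)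

/-- The two pieces of the sequence `p` before and after the step `cut` are self-avoiding, but they
meet, unless the second piece is empty. -/
def IsBlock (cut : ℕ) {ℓ : ℕ} (p : Fin (ℓ + 1) → Fin n) : Prop :=
  Set.InjOn p {t : Fin (ℓ + 1) | (t : ℕ) ≤ cut} ∧
    Set.InjOn p {t : Fin (ℓ + 1) | cut < (t : ℕ)} ∧ (cut < ℓ → ¬ Function.Injective p)

open Classical in
/-- The common generalization of `Δ^{(ℓ)}` and `Γ^{ℓ,m}`. -/
def blockMatrix (a b : ℝ) (s : Fin n → ℤˣ) (G : SimpleGraph (Fin n)) (ℓ cut : ℕ) :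
    Matrix (Fin n) (Fin n) ℝ :=
  Matrix.of fun i j =>
    ∑ p : Fin (ℓ + 1) → Fin n with IsBlock cut p ∧ p 0 = i ∧ p (Fin.last ℓ) = j,
      blockWeight a b s G cut p

lemma deltaMatrix_eq_blockMatrix (a b : ℝ) (s : Fin n → ℤˣ) (G : SimpleGraph (Fin n)) (ℓ : ℕ) :
    deltaMatrix a b s G ℓ = blockMatrix a b s G ℓ ℓ := by
  classical
  ext i j
  simp only [deltaMatrix, blockMatrix, Matrix.of_apply]
  refine Finset.sum_congr (Finset.filter_congr fun p _ => ?_) fun p _ => ?_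
  · have h1 : {t : Fin (ℓ + 1) | (t : ℕ) ≤ ℓ} = Set.univ := by
      ext t; simp; omega
    have h2 : {t : Fin (ℓ + 1) | ℓ < (t : ℕ)} = ∅ := by
      ext t; simp; omega
    simp [IsBlock, h1, h2, Set.injOn_univ]
  · exact Finset.prod_congr rfl fun t _ => by rw [if_pos t.2]

lemma gammaMatrix_eq_blockMatrix (a b : ℝ) (s : Fin n → ℤˣ) (G : SimpleGraph (Fin n)) {ℓ m : ℕ}
    (hm : m ∈ Finset.Icc 1 ℓ) : gammaMatrix a b s G ℓ m = blockMatrix a b s G ℓ (ℓ - m) := by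
  classical
  have hm' := Finset.mem_Icc.1 hm
  have h : ℓ - m < ℓ := by omega
  ext i j
  simp only [gammaMatrix, blockMatrix, Matrix.of_apply]
  refine Finset.sum_congr (Finset.filter_congr fun p _ => ?_) fun p _ => rfl
  simp only [IsBlock, h, true_imp_iff]
  tauto

lemma IsBlock.step_ne {cut ℓ : ℕ} {p : Fin (ℓ + 1) → Fin n} (h : IsBlock cut p) {t : Fin ℓ}
    (ht : (t : ℕ) ≠ cut) : p t.castSucc ≠ p t.succ := by
  intro e
  have key : t.castSucc = t.succ := by
    rcases lt_or_gt_of_ne ht with h1 | h1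
    · exact h.1 (by simp; omega) (by simp; omega) e
    · exact h.2.1 (by simp; omega) (by simp; omega) e
  exact absurd key (Fin.castSucc_lt_succ (i := t)).ne

/-- The edges of a family of sequences, the averaged steps being left out. -/
def familyEdges (cut : ℕ) {ℓ K : ℕ} (P : Fin K → Fin (ℓ + 1) → Fin n) : Finset (Sym2 (Fin n)) :=
  Finset.univ.image fun x : {x : Fin K × Fin ℓ // (x.2 : ℕ) ≠ cut} =>
    s(P x.1.1 x.1.2.castSucc, P x.1.1 x.1.2.succ)

lemma prod_fin_ite_eq (ℓ cut : ℕ) (ρ : ℝ) :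
    ∏ t : Fin ℓ, (if (t : ℕ) = cut then ρ else 1) = if cut < ℓ then ρ else 1 := by
  split_ifs with h
  · rw [Finset.prod_eq_single ⟨cut, h⟩]
    · simp
    · intro t _ ht
      rw [if_neg fun e => ht (Fin.ext e)]
    · simp
  · exact Finset.prod_eq_one fun t _ => if_neg (by omega)

/-- Before the cut the steps count one, after it two. The averaged step is also counted as two in
the bound, which only enlarges it. -/
lemma sum_stepCount_le {ℓ cut : ℕ} (h : cut ≤ ℓ) (K : ℕ) :
    ∑ x : {x : Fin K × Fin ℓ // (x.2 : ℕ) ≠ cut}, (if (x.1.2 : ℕ) < cut then 1 else 2) ≤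
      K * (ℓ + (ℓ - cut)) := by
  classical
  have h1 : ∑ x : {x : Fin K × Fin ℓ // (x.2 : ℕ) ≠ cut}, (if (x.1.2 : ℕ) < cut then 1 else 2) =
      ∑ x ∈ ({x | (x.2 : ℕ) ≠ cut} : Finset (Fin K × Fin ℓ)), (if (x.2 : ℕ) < cut then 1 else 2) := by
    symm
    apply Finset.sum_subtype
    simp
  rw [h1]
  refine (Finset.sum_le_sum_of_subset (Finset.filter_subset _ _)).trans ?_
  have h2 : ∑ x : Fin K × Fin ℓ, (if (x.2 : ℕ) < cut then 1 else 2) =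
      ∑ _r : Fin K, ∑ t : Fin ℓ, (if (t : ℕ) < cut then 1 else 2) := Fintype.sum_prod_type _
  rw [h2, Finset.sum_const, Finset.card_univ, Fintype.card_fin, smul_eq_mul]
  apply Nat.mul_le_mul_left
  rw [Fin.sum_univ_eq_sum_range fun t => if t < cut then 1 else 2]
  obtain ⟨m, rfl⟩ := Nat.exists_eq_add_of_le h
  rw [Finset.sum_range_add]
  have e1 : ∑ t ∈ Finset.range cut, (if t < cut then 1 else 2) = cut := by
    rw [Finset.sum_congr rfl fun t ht => if_pos (Finset.mem_range.1 ht)]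
    simp
  have e2 : ∑ t ∈ Finset.range m, (if cut + t < cut then 1 else 2) = 2 * m := by
    rw [Finset.sum_congr rfl fun t ht => if_neg (by omega)]
    simp [mul_comm]
  omega

/-- Given the spins, the averaged steps are deterministic. They come out as the constant `C`, with
one factor at most `ρ` per sequence when `cut < ℓ`. -/
lemma abs_expectation_family_le {a b : ℝ} (s : Fin n → ℤˣ) {ρ : ℝ}
    (hρ : ∀ x y, edgePr a b n x y ≤ ρ) {ℓ cut K : ℕ} (hcut : cut ≤ ℓ)
    (P : Fin K → Fin (ℓ + 1) → Fin n) (hP : ∀ r, IsBlock cut (P r)) :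
    |∑ G, (graphLaw a b n s G).toReal * ∏ r, blockWeight a b s G cut (P r)| ≤
      (if cut < ℓ then ρ else 1) ^ K *
        if 2 * (familyEdges cut P).card ≤ K * (ℓ + (ℓ - cut))
        then ∏ e ∈ familyEdges cut P, edgeWeight a b n s e else 0 := by
  classical
  have hρ0 : 0 ≤ ρ := (edgePr_nonneg a b n 1 1).trans (hρ 1 1)
  set C : ℝ := ∏ r : Fin K, ∏ t : Fin ℓ,
    (if (t : ℕ) = cut then meanAdj a b n s (P r t.castSucc) (P r t.succ) else 1) with hC
  have hsplit : ∀ G, ∏ r, blockWeight a b s G cut (P r) =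
      C * ∏ x : {x : Fin K × Fin ℓ // (x.2 : ℕ) ≠ cut},
        (adj G (P x.1.1 x.1.2.castSucc) (P x.1.1 x.1.2.succ) - if (x.1.2 : ℕ) < cut then
          meanAdj a b n s (P x.1.1 x.1.2.castSucc) (P x.1.1 x.1.2.succ) else 0) := by
    intro G
    have h1 : ∏ x : {x : Fin K × Fin ℓ // (x.2 : ℕ) ≠ cut},
        (adj G (P x.1.1 x.1.2.castSucc) (P x.1.1 x.1.2.succ) - if (x.1.2 : ℕ) < cut then
          meanAdj a b n s (P x.1.1 x.1.2.castSucc) (P x.1.1 x.1.2.succ) else 0) =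
        ∏ x : Fin K × Fin ℓ, if (x.2 : ℕ) ≠ cut then
        (adj G (P x.1 x.2.castSucc) (P x.1 x.2.succ) - if (x.2 : ℕ) < cut then
          meanAdj a b n s (P x.1 x.2.castSucc) (P x.1 x.2.succ) else 0) else 1 := by
      rw [← Finset.prod_filter]
      symm
      apply Finset.prod_subtype
      simp
    rw [h1, Fintype.prod_prod_type, hC, ← Finset.prod_mul_distrib]
    refine Finset.prod_congr rfl fun r _ => ?_
    rw [blockWeight, ← Finset.prod_mul_distrib]
    refine Finset.prod_congr rfl fun t _ => ?_
    rcases lt_trichotomy (t : ℕ) cut with h | h | h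
    · simp [h, h.ne]
    · simp [h]
    · simp [h.not_gt, h.ne']
  have hCle : |C| ≤ (if cut < ℓ then ρ else 1) ^ K := by
    rw [hC, Finset.abs_prod]
    calc _ ≤ ∏ r : Fin K, (if cut < ℓ then ρ else 1) := by
          refine Finset.prod_le_prod (fun _ _ => abs_nonneg _) fun r _ => ?_
          rw [Finset.abs_prod, ← prod_fin_ite_eq]
          refine Finset.prod_le_prod (fun _ _ => abs_nonneg _) fun t _ => ?_
          by_cases h : (t : ℕ) = cut
          · rw [if_pos h, if_pos h, meanAdj_apply]
            split_ifs
            · simpa using hρ0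
            · rw [abs_of_nonneg (edgePr_nonneg _ _ _ _ _)]
              exact hρ _ _
          · simp [h]
      _ = _ := by simp
  simp_rw [hsplit]
  have hre : ∑ G, (graphLaw a b n s G).toReal *
      (C * ∏ x : {x : Fin K × Fin ℓ // (x.2 : ℕ) ≠ cut},
        (adj G (P x.1.1 x.1.2.castSucc) (P x.1.1 x.1.2.succ) - if (x.1.2 : ℕ) < cut then
          meanAdj a b n s (P x.1.1 x.1.2.castSucc) (P x.1.1 x.1.2.succ) else 0)) =
      C * ∑ G, (graphLaw a b n s G).toReal *
        ∏ x : {x : Fin K × Fin ℓ // (x.2 : ℕ) ≠ cut},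
        (adj G (P x.1.1 x.1.2.castSucc) (P x.1.1 x.1.2.succ) - if (x.1.2 : ℕ) < cut then
          meanAdj a b n s (P x.1.1 x.1.2.castSucc) (P x.1.1 x.1.2.succ) else 0) := by
    rw [Finset.mul_sum]
    exact Finset.sum_congr rfl fun G _ => by ring
  rw [hre, abs_mul]
  have hmain := abs_expectation_prod_le a b n s
    (fun x : {x : Fin K × Fin ℓ // (x.2 : ℕ) ≠ cut} => P x.1.1 x.1.2.castSucc)
    (fun x => P x.1.1 x.1.2.succ) (fun x => (hP x.1.1).step_ne x.2)
    (fun x => (x.1.2 : ℕ) < cut)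
  refine mul_le_mul hCle (hmain.trans ?_) (abs_nonneg _) ((abs_nonneg _).trans hCle)
  change (if 2 * (familyEdges cut P).card ≤ _
    then ∏ e ∈ familyEdges cut P, edgeWeight a b n s e else 0) ≤ _
  have h0 : 0 ≤ ∏ e ∈ familyEdges cut P, edgeWeight a b n s e :=
    Finset.prod_nonneg fun e _ => edgeWeight_nonneg _ _ _ _ _
  have := sum_stepCount_le hcut K
  split_ifs
  · exact le_rfl
  · omega
  · exact h0
  · exact le_rfl

end Blocks

/-! ### Chains of sequences and their concatenation into one walk. -/

section Family

variable {n ℓ : ℕ}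

/-- The first node of the `r`-th sequence of a chain: every other sequence is read backwards. -/
def chainSrc (r : ℕ) (p : Fin (ℓ + 1) → Fin n) : Fin n := if Even r then p 0 else p (Fin.last ℓ)

/-- The last node of the `r`-th sequence of a chain: every other sequence is read backwards. -/
def chainTgt (r : ℕ) (p : Fin (ℓ + 1) → Fin n) : Fin n := if Even r then p (Fin.last ℓ) else p 0

/-- The sequences of the family `P`, read forwards and backwards in turn, lead from `i` to `j`. -/
def IsChainFrom : (K : ℕ) → (Fin K → Fin (ℓ + 1) → Fin n) → Fin n → Fin n → Prop
  | 0, _, i, j => i = j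
  | K + 1, P, i, j => IsChainFrom K (fun r => P r.castSucc) i (chainSrc K (P (Fin.last K))) ∧
      chainTgt K (P (Fin.last K)) = j

/-- Consecutive sequences of a chain share an end node, so a chain of connected sequences is
connected. -/
lemma IsChainFrom.iff_of_iff {f : Fin n → Prop} : ∀ {K : ℕ} {P : Fin K → Fin (ℓ + 1) → Fin n}
    {i j : Fin n}, IsChainFrom K P i j → (∀ r t t', f (P r t) → f (P r t')) →
    (∀ r t, f (P r t) ↔ f i) ∧ (f j ↔ f i) := by
  intro K
  induction K with
  | zero =>
    intro P i j h _
    have h' : i = j := h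
    subst h'
    exact ⟨fun r => r.elim0, Iff.rfl⟩
  | succ K ih =>
    intro P i j h hf
    obtain ⟨h1, h2⟩ := ih h.1 fun r t t' => hf _ t t'
    have hsrc : ∀ t, f (P (Fin.last K) t) ↔ f (chainSrc K (P (Fin.last K))) := by
      intro t
      unfold chainSrc
      split_ifs
      · exact ⟨hf _ _ _, hf _ _ _⟩
      · exact ⟨hf _ _ _, hf _ _ _⟩
    have hlast : ∀ t, f (P (Fin.last K) t) ↔ f i := fun t => (hsrc t).trans h2
    constructor
    · intro r
      induction r using Fin.lastCases with
      | last => exact hlast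
      | cast r => exact h1 r
    · rw [← h.2]
      unfold chainTgt
      split_ifs
      · exact hlast _
      · exact hlast _

/-- A block stays connected without its averaged step: each piece is injective but the whole is not,
so the two pieces share a node. This is the role of the non-injectivity in `Γ`. -/
lemma IsBlock.iff_of_iff {f : Fin n → Prop} {cut : ℕ} {p : Fin (ℓ + 1) → Fin n}
    (h : IsBlock cut p)
    (hf : ∀ t : Fin ℓ, (t : ℕ) ≠ cut → (f (p t.castSucc) ↔ f (p t.succ))) :
    ∀ t, f (p t) ↔ f (p 0) := by
  have h1 : ∀ k (hk : k < ℓ + 1), k ≤ cut → (f (p ⟨k, hk⟩) ↔ f (p 0)) := by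
    intro k
    induction k with
    | zero => intro _ _; exact Iff.rfl
    | succ k ih =>
      intro hk hc
      rw [← ih (by omega) (by omega)]
      exact (hf ⟨k, by omega⟩ (by simp; omega)).symm
  have h2 : ∀ k (hk : k < ℓ + 1) (hc : cut < k),
      (f (p ⟨k, hk⟩) ↔ f (p ⟨cut + 1, by omega⟩)) := by
    intro k
    induction k with
    | zero => intro _ hc; omega
    | succ k ih =>
      intro hk hc
      rcases (Nat.lt_succ_iff.1 hc).lt_or_eq with hc' | hc'
      · rw [← ih (by omega) hc']
        exact (hf ⟨k, by omega⟩ (by simp; omega)).symm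
      · subst hc'; exact Iff.rfl
  intro t
  rcases Nat.lt_or_ge cut t with ht | ht
  · rw [h2 t t.2 ht]
    have hni := h.2.2 (by omega)
    simp only [Function.Injective, not_forall] at hni
    obtain ⟨x, y, hxy, hne⟩ := hni
    have key : ∀ x y : Fin (ℓ + 1), p x = p y → (x : ℕ) ≤ cut → cut < (y : ℕ) →
        (f (p ⟨cut + 1, by omega⟩) ↔ f (p 0)) := by
      intro x y hxy hx hy
      rw [← h2 y y.2 hy, ← h1 x x.2 hx]
      change f (p y) ↔ f (p x)
      rw [hxy]
    rcases Nat.lt_or_ge cut x with hx | hx <;> rcases Nat.lt_or_ge cut y with hy | hy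
    · exact absurd (h.2.1 hx hy hxy) hne
    · exact key y x hxy.symm hy hx
    · exact key x y hxy hx hy
    · exact absurd (h.1 hx hy hxy) hne
  · exact h1 t t.2 ht

variable {K : ℕ} [NeZero K]

/-- The sequences of the family `P`, one after the other. -/
def familyWalk (P : Fin K → Fin (ℓ + 1) → Fin n) (τ : ℕ) : Fin n :=
  P (Fin.ofNat K (τ / (ℓ + 1))) (Fin.ofNat (ℓ + 1) τ)

lemma familyWalk_apply (P : Fin K → Fin (ℓ + 1) → Fin n) {r t : ℕ} (hr : r < K) (ht : t < ℓ + 1) :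
    familyWalk P ((ℓ + 1) * r + t) = P ⟨r, hr⟩ ⟨t, ht⟩ := by
  unfold familyWalk
  congr 1
  · ext
    simp only [Fin.val_ofNat]
    rw [Nat.mul_add_div (Nat.succ_pos ℓ), Nat.div_eq_of_lt ht, add_zero, Nat.mod_eq_of_lt hr]
  · ext
    simp only [Fin.val_ofNat]
    rw [Nat.mul_add_mod, Nat.mod_eq_of_lt ht]

/-- The number of steps of the concatenation of `K` sequences of `ℓ + 1` nodes. -/
def familyLength (ℓ K : ℕ) : ℕ := K * (ℓ + 1) - 1

omit [NeZero K] in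
lemma exists_block_index {τ : ℕ} (hτ : τ < K * (ℓ + 1)) :
    ∃ r t, r < K ∧ t < ℓ + 1 ∧ τ = (ℓ + 1) * r + t :=
  ⟨τ / (ℓ + 1), τ % (ℓ + 1), Nat.div_lt_of_lt_mul (by rwa [mul_comm]),
    Nat.mod_lt _ (Nat.succ_pos ℓ), (Nat.div_add_mod τ (ℓ + 1)).symm⟩

lemma familyLength_succ (ℓ K : ℕ) [NeZero K] : familyLength ℓ K + 1 = K * (ℓ + 1) := by
  have : 0 < K * (ℓ + 1) := Nat.mul_pos (NeZero.pos K) (Nat.succ_pos ℓ)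
  unfold familyLength; omega

omit [NeZero K] in
lemma block_index_lt {r t : ℕ} (hr : r < K) (ht : t < ℓ + 1) : (ℓ + 1) * r + t < K * (ℓ + 1) := by
  calc (ℓ + 1) * r + t < (ℓ + 1) * r + (ℓ + 1) := by omega
    _ = (ℓ + 1) * (r + 1) := by ring
    _ ≤ (ℓ + 1) * K := Nat.mul_le_mul_left _ hr
    _ = _ := mul_comm _ _

/-- The steps of the concatenation which are averaged, or which lead to the next sequence. -/
def familyJumps (ℓ K cut : ℕ) : Finset ℕ :=
  {τ ∈ Finset.range (familyLength ℓ K) | τ % (ℓ + 1) = cut ∨ τ % (ℓ + 1) = ℓ}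

lemma familyWalk_determines {P Q : Fin K → Fin (ℓ + 1) → Fin n}
    (h : ∀ τ ≤ familyLength ℓ K, familyWalk P τ = familyWalk Q τ) : P = Q := by
  ext r t : 2
  have h1 := block_index_lt r.2 t.2
  rw [← familyLength_succ] at h1
  have := h _ (Nat.lt_succ_iff.1 h1)
  rwa [familyWalk_apply P r.2 t.2, familyWalk_apply Q r.2 t.2] at this

lemma mem_image_familyWalk {P : Fin K → Fin (ℓ + 1) → Fin n} {x : Fin n} :
    x ∈ (Finset.range (familyLength ℓ K + 1)).image (familyWalk P) ↔ ∃ r t, P r t = x := by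
  rw [familyLength_succ]
  constructor
  · intro h
    obtain ⟨τ, hτ, rfl⟩ := Finset.mem_image.1 h
    obtain ⟨r, t, hr, ht, rfl⟩ := exists_block_index (Finset.mem_range.1 hτ)
    exact ⟨_, _, (familyWalk_apply P hr ht).symm⟩
  · rintro ⟨r, t, rfl⟩
    exact Finset.mem_image.2 ⟨_, Finset.mem_range.2 (block_index_lt r.2 t.2),
      familyWalk_apply P r.2 t.2⟩

omit [NeZero K] in
lemma card_le_two_mul {s : Finset ℕ} (hs : ∀ τ ∈ s, τ < K * (ℓ + 1)) (c : ℕ → Bool)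
    (h : ∀ r t t', (ℓ + 1) * r + t ∈ s → (ℓ + 1) * r + t' ∈ s → r < K → t < ℓ + 1 → t' < ℓ + 1 →
      c t = c t' → t = t') : s.card ≤ 2 * K := by
  have hcard : (Finset.range K ×ˢ (Finset.univ : Finset Bool)).card = 2 * K := by
    simp [mul_comm]
  rw [← hcard]
  apply Finset.card_le_card_of_injOn (fun τ => (τ / (ℓ + 1), c (τ % (ℓ + 1))))
  · intro τ hτ
    have := Nat.div_lt_of_lt_mul (by have := hs τ hτ; rwa [mul_comm] at this : τ < (ℓ + 1) * K)
    simpa using this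
  · intro τ hτ τ' hτ' he
    obtain ⟨r, t, hr, ht, rfl⟩ := exists_block_index (hs τ hτ)
    obtain ⟨r', t', hr', ht', rfl⟩ := exists_block_index (hs τ' hτ')
    simp only [Prod.mk.injEq, Nat.mul_add_div (Nat.succ_pos ℓ), Nat.div_eq_of_lt ht,
      Nat.div_eq_of_lt ht', add_zero, Nat.mul_add_mod, Nat.mod_eq_of_lt ht,
      Nat.mod_eq_of_lt ht'] at he
    obtain ⟨rfl, he⟩ := he
    rw [h r t t' hτ hτ' hr ht ht' he]

lemma card_familyJumps_le (ℓ K cut : ℕ) [NeZero K] : (familyJumps ℓ K cut).card ≤ 2 * K := by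
  apply card_le_two_mul (ℓ := ℓ) _ (fun t => decide (t = ℓ))
  · intro r t t' h1 h2 _ ht ht' hc
    simp only [familyJumps, Finset.mem_filter, Nat.mul_add_mod, Nat.mod_eq_of_lt ht,
      Nat.mod_eq_of_lt ht'] at h1 h2
    by_cases e : t = ℓ <;> by_cases e' : t' = ℓ <;> simp [e, e'] at hc <;> omega
  · intro τ hτ
    have := Finset.mem_range.1 (Finset.mem_filter.1 hτ).1
    have := familyLength_succ ℓ K
    omega

lemma exists_step_index {cut τ : ℕ} (h : τ < familyLength ℓ K) (hJ : τ ∉ familyJumps ℓ K cut) :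
    ∃ r t, r < K ∧ t < ℓ ∧ t ≠ cut ∧ τ = (ℓ + 1) * r + t := by
  have h' := familyLength_succ ℓ K
  obtain ⟨r, t, hr, ht, rfl⟩ := exists_block_index (show τ < K * (ℓ + 1) by omega)
  simp only [familyJumps, Finset.mem_filter, Finset.mem_range, h, true_and, Nat.mul_add_mod,
    Nat.mod_eq_of_lt ht, not_or] at hJ
  exact ⟨r, t, hr, by omega, hJ.1, rfl⟩

/-- All sequences are read forwards in the concatenation, unlike in the chain. The steps joining two
sequences need not follow edges; they lie in `familyJumps` and are discarded. -/
lemma walkEdges_familyWalk_subset (P : Fin K → Fin (ℓ + 1) → Fin n) (cut : ℕ) :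
    walkEdges (familyWalk P) (familyLength ℓ K) (familyJumps ℓ K cut) ⊆ familyEdges cut P := by
  intro e he
  obtain ⟨τ, hτ, rfl⟩ := Finset.mem_image.1 he
  obtain ⟨h1, h2⟩ := Finset.mem_sdiff.1 hτ
  obtain ⟨r, t, hr, ht, hc, rfl⟩ := exists_step_index (Finset.mem_range.1 h1) h2
  refine Finset.mem_image.2 ⟨⟨(⟨r, hr⟩, ⟨t, ht⟩), hc⟩, Finset.mem_univ _, ?_⟩
  rw [add_assoc, familyWalk_apply P hr (by omega), familyWalk_apply P hr (by omega)]
  rfl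

lemma familyWalk_ne_of_not_jump {P : Fin K → Fin (ℓ + 1) → Fin n} {cut : ℕ}
    (hP : ∀ r, IsBlock cut (P r)) (τ : ℕ) (hτ : τ + 1 < familyLength ℓ K)
    (h : familyWalk P τ = familyWalk P (τ + 2)) :
    τ ∈ familyJumps ℓ K cut ∨ τ + 1 ∈ familyJumps ℓ K cut := by
  by_contra! hcon
  obtain ⟨r, t, hr, ht, hc, rfl⟩ := exists_step_index (by omega) hcon.1
  have ht1 : t + 1 < ℓ + 1 := by omega
  have h1 := hcon.2
  rw [add_assoc] at h1 hτ h
  simp only [familyJumps, Finset.mem_filter, Finset.mem_range, hτ, true_and, Nat.mul_add_mod,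
    Nat.mod_eq_of_lt ht1, not_or] at h1
  rw [familyWalk_apply P hr (by omega), familyWalk_apply P hr (by omega : t + 2 < ℓ + 1)] at h
  have key : (⟨t, by omega⟩ : Fin (ℓ + 1)) = ⟨t + 2, by omega⟩ := by
    rcases lt_or_gt_of_ne hc with h2 | h2
    · exact (hP _).1 (by simp; omega) (by simp; omega) h
    · exact (hP _).2.1 (by simp; omega) (by simp; omega) h
  simp at key

/-- Each of the two self-avoiding pieces of a sequence traverses a given edge at most once. -/
lemma card_familyWalk_edge_le {P : Fin K → Fin (ℓ + 1) → Fin n} {cut : ℕ}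
    (hP : ∀ r, IsBlock cut (P r)) (e : Sym2 (Fin n)) :
    ({τ ∈ Finset.range (familyLength ℓ K) \ familyJumps ℓ K cut |
      s(familyWalk P τ, familyWalk P (τ + 1)) = e}).card ≤ 2 * K := by
  apply card_le_two_mul (ℓ := ℓ) _ (fun t => decide (t < cut))
  · intro r t t' h1 h2 hr ht ht' hc
    simp only [familyJumps, Finset.mem_filter, Finset.mem_sdiff, Finset.mem_range,
      Nat.mul_add_mod, Nat.mod_eq_of_lt ht, Nat.mod_eq_of_lt ht'] at h1 h2
    obtain ⟨⟨h1, h3⟩, h4⟩ := h1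
    obtain ⟨⟨h2, h5⟩, h6⟩ := h2
    simp only [h1, h2, true_and, not_or] at h3 h5
    have g1 : t + 1 < ℓ + 1 := by omega
    have g2 : t' + 1 < ℓ + 1 := by omega
    rw [← h6, add_assoc, add_assoc, familyWalk_apply P hr ht, familyWalk_apply P hr ht',
      familyWalk_apply P hr g1, familyWalk_apply P hr g2] at h4
    have key : ∀ x y : Fin (ℓ + 1), ((x : ℕ) ≤ cut ∧ (y : ℕ) ≤ cut ∨ cut < (x : ℕ) ∧ cut < (y : ℕ)) →
        P ⟨r, hr⟩ x = P ⟨r, hr⟩ y → (x : ℕ) = y := by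
      intro x y hxy he
      rcases hxy with ⟨hx, hy⟩ | ⟨hx, hy⟩
      · rw [(hP _).1 hx hy he]
      · rw [(hP _).2.1 hx hy he]
    have hiff : t < cut ↔ t' < cut := by simpa using hc
    rcases Sym2.eq_iff.1 h4 with ⟨ha, _⟩ | ⟨ha, hb⟩
    · exact key _ _ (by simp only; omega) ha
    · have k1 := key _ _ (by simp only; omega) ha
      have k2 := key _ _ (by simp only; omega) hb
      simp only at k1 k2
      omega
  · intro τ hτ
    have := Finset.mem_range.1 (Finset.mem_sdiff.1 (Finset.mem_filter.1 hτ).1).1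
    have := familyLength_succ ℓ K
    omega

/-- The bound on changes with `μ = 2 * K` and at most `2 * K` jumps. What matters is that the
additive constant does not depend on `ℓ`. -/
lemma card_stepCode_familyWalk_le {P : Fin K → Fin (ℓ + 1) → Fin n} {cut : ℕ}
    (hP : ∀ r, IsBlock cut (P r)) :
    ({τ ∈ Finset.range (familyLength ℓ K) | stepCode (familyWalk P) (familyLength ℓ K) τ ≠ 0}).card +
        12 * K * (((Finset.range (familyLength ℓ K + 1)).image (familyWalk P)).card - 1) ≤
      (3 + 24 * K + 24 * K ^ 2) + 12 * K * (familyEdges cut P).card := by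
  have h := card_stepCode_add_le (familyWalk P) (familyLength ℓ K) (familyJumps ℓ K cut) (2 * K)
    (familyWalk_ne_of_not_jump hP) (card_familyWalk_edge_le hP)
  have h1 := card_familyJumps_le ℓ K cut
  have h2 := Finset.card_le_card (walkEdges_familyWalk_subset P cut)
  have h3 : 6 * (2 * K) * (familyJumps ℓ K cut).card ≤ 6 * (2 * K) * (2 * K) :=
    Nat.mul_le_mul_left _ h1
  have h4 : 6 * (2 * K) * (walkEdges (familyWalk P) (familyLength ℓ K)
      (familyJumps ℓ K cut)).card ≤ 6 * (2 * K) * (familyEdges cut P).card :=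
    Nat.mul_le_mul_left _ h2
  have e1 : 6 * (2 * K) = 12 * K := by ring
  have e2 : 12 * K * (2 * K) = 24 * K ^ 2 := by ring
  rw [e1] at h h3 h4
  rw [e2] at h3
  omega

lemma sum_prod_edgeWeight_family_le {a b q ρ : ℝ}
    (hq : ∀ x y, edgePr a b n x y + edgePr a b n x (-y) = 2 * q)
    (hρ : ∀ x y, edgePr a b n x y ≤ ρ) {P : Fin K → Fin (ℓ + 1) → Fin n} {cut : ℕ}
    (hP : ∀ r, IsBlock cut (P r)) {i j : Fin n} (hch : IsChainFrom K P i j) {v : ℕ}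
    (hv : v = ((Finset.range (familyLength ℓ K + 1)).image (familyWalk P)).card) :
    v - 1 ≤ (familyEdges cut P).card ∧
      ∑ σ : Fin n → ℤˣ, ∏ e ∈ familyEdges cut P, edgeWeight a b n σ e ≤
        2 ^ n * (q ^ (v - 1) * ρ ^ ((familyEdges cut P).card - (v - 1))) := by
  rw [hv]
  have h := sum_prod_spinWeight_le (E := familyEdges cut P)
    (S₀ := (Finset.range (familyLength ℓ K + 1)).image (familyWalk P))
    ⟨_, Finset.mem_image_of_mem _ (Finset.mem_range.2 (Nat.succ_pos _))⟩ ?_ ?_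
    (edgePr_comm a b n) hq (edgePr_nonneg a b n) hρ
  · simpa using h
  · intro u w huw
    obtain ⟨x, _, hx⟩ := Finset.mem_image.1 huw
    rw [mem_image_familyWalk]
    rcases Sym2.eq_iff.1 hx with ⟨h1, _⟩ | ⟨_, h1⟩
    · exact ⟨_, _, h1⟩
    · exact ⟨_, _, h1⟩
  · intro f hf u hu w hw
    obtain ⟨r, t, rfl⟩ := mem_image_familyWalk.1 hu
    obtain ⟨r', t', rfl⟩ := mem_image_familyWalk.1 hw
    have hblock : ∀ r t, f (P r t) ↔ f (P r 0) := by
      intro r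
      refine (hP r).iff_of_iff fun t ht => ?_
      exact hf _ _ (Finset.mem_image.2 ⟨⟨(r, t), ht⟩, Finset.mem_univ _, rfl⟩)
    have := (hch.iff_of_iff fun r t t' h => (hblock r t').2 ((hblock r t).1 h)).1
    exact fun h => (this r' t').2 ((this r t).1 h)

end Family

/-! ### The spectral norm and traces of alternating products. -/

section Trace

variable {n : ℕ}

lemma specNorm_sq_le (N : Matrix (Fin n) (Fin n) ℝ) : specNorm N ^ 2 ≤ ∑ i, ∑ j, N i j ^ 2 := by
  have h0 : 0 ≤ ∑ i, ∑ j, N i j ^ 2 :=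
    Finset.sum_nonneg fun i _ => Finset.sum_nonneg fun j _ => sq_nonneg _
  have h : specNorm N ≤ Real.sqrt (∑ i, ∑ j, N i j ^ 2) := by
    refine ContinuousLinearMap.opNorm_le_bound _ (Real.sqrt_nonneg _) fun x => ?_
    refine (sq_le_sq₀ (norm_nonneg _) (by positivity)).1 ?_
    rw [mul_pow, Real.sq_sqrt h0, EuclideanSpace.norm_sq_eq, EuclideanSpace.norm_sq_eq,
      Finset.sum_mul]
    refine Finset.sum_le_sum fun i _ => ?_
    have e : (Matrix.toEuclideanCLM (n := Fin n) (𝕜 := ℝ) N x) i = ∑ j, N i j * x j := by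
      rfl
    rw [e]
    simp only [Real.norm_eq_abs, sq_abs]
    exact Finset.sum_mul_sq_le_sq_mul_sq _ _ _
  calc specNorm N ^ 2 ≤ Real.sqrt (∑ i, ∑ j, N i j ^ 2) ^ 2 :=
        pow_le_pow_left₀ (norm_nonneg _) h 2
    _ = _ := Real.sq_sqrt h0

/-- The C*-identity gives the norm of `(M * M.transpose) ^ 2 ^ j` exactly, by repeated squaring,
whence the powers of two. The square of this norm is at most the squared Frobenius norm, which is a
trace since the matrix is symmetric. -/
lemma specNorm_pow_le_trace (M : Matrix (Fin n) (Fin n) ℝ) (j : ℕ) :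
    specNorm M ^ (2 ^ (j + 2)) ≤ ((M * M.transpose) ^ (2 ^ (j + 1))).trace := by
  set x := Matrix.toEuclideanCLM (n := Fin n) (𝕜 := ℝ) M with hx
  have hstar : Matrix.toEuclideanCLM (n := Fin n) (𝕜 := ℝ) M.transpose = star x := by
    rw [hx, ← map_star]
    congr 1
  have h1 : ‖x * star x‖ = specNorm M ^ 2 := by
    rw [sq]
    exact CStarRing.norm_self_mul_star (x := x)
  have h2 : specNorm ((M * M.transpose) ^ (2 ^ j)) = specNorm M ^ (2 ^ (j + 1)) := by
    rw [specNorm, map_pow, map_mul, hstar, (IsSelfAdjoint.mul_star_self x).norm_pow_two_pow, h1,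
      ← pow_mul, ← pow_succ']
  have h3 := specNorm_sq_le ((M * M.transpose) ^ (2 ^ j))
  have hsymm : ((M * M.transpose) ^ (2 ^ j)).transpose = (M * M.transpose) ^ (2 ^ j) := by
    rw [Matrix.transpose_pow, Matrix.transpose_mul, Matrix.transpose_transpose]
  calc specNorm M ^ (2 ^ (j + 2)) = specNorm ((M * M.transpose) ^ (2 ^ j)) ^ 2 := by
        rw [h2, ← pow_mul, ← pow_succ]
    _ ≤ _ := h3
    _ = ((M * M.transpose) ^ (2 ^ j) * ((M * M.transpose) ^ (2 ^ j)).transpose).trace := by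
        simp only [Matrix.trace, Matrix.diag, Matrix.mul_apply, Matrix.transpose_apply, sq]
    _ = _ := by rw [hsymm, ← pow_add, ← two_mul, ← pow_succ']

/-- The product `M Mᵀ M ⋯` of `K` factors. -/
def altProd (M : Matrix (Fin n) (Fin n) ℝ) : ℕ → Matrix (Fin n) (Fin n) ℝ
  | 0 => 1
  | K + 1 => altProd M K * if Even K then M else M.transpose

lemma altProd_two_mul (M : Matrix (Fin n) (Fin n) ℝ) (k : ℕ) :
    altProd M (2 * k) = (M * M.transpose) ^ k := by
  induction k with
  | zero => rfl
  | succ k ih =>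
    have e : 2 * (k + 1) = 2 * k + 1 + 1 := by ring
    rw [e, altProd, altProd, ih, pow_succ, if_pos (even_two_mul k), if_neg (by simp),
      Matrix.mul_assoc]

open Classical in
lemma altProd_blockMatrix_apply (a b : ℝ) (s : Fin n → ℤˣ) (G : SimpleGraph (Fin n)) (ℓ cut : ℕ)
    (K : ℕ) : ∀ i j, altProd (blockMatrix a b s G ℓ cut) K i j =
      ∑ P : Fin K → Fin (ℓ + 1) → Fin n with (∀ r, IsBlock cut (P r)) ∧ IsChainFrom K P i j,
        ∏ r, blockWeight a b s G cut (P r) := by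
  induction K with
  | zero =>
    intro i j
    rw [Finset.sum_filter, Fintype.sum_unique]
    simp [altProd, IsChainFrom, Matrix.one_apply]
  | succ K ih =>
    intro i j
    have hM : ∀ k, (if Even K then blockMatrix a b s G ℓ cut
        else (blockMatrix a b s G ℓ cut).transpose) k j =
        ∑ p : Fin (ℓ + 1) → Fin n, if IsBlock cut p ∧ chainSrc K p = k ∧ chainTgt K p = j then
          blockWeight a b s G cut p else 0 := by
      intro k
      unfold chainSrc chainTgt
      split_ifs
      · simp only [blockMatrix, Matrix.of_apply, Finset.sum_filter]
      · simp only [blockMatrix, Matrix.of_apply, Matrix.transpose_apply, Finset.sum_filter]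
        exact Finset.sum_congr rfl fun p _ => by simp only [and_comm]
    rw [altProd, Matrix.mul_apply, Finset.sum_filter]
    simp_rw [ih, hM, Finset.sum_filter, Finset.sum_mul_sum]
    rw [← Equiv.sum_comp (Fin.snocEquiv fun _ => Fin (ℓ + 1) → Fin n), Fintype.sum_prod_type_right,
      Finset.sum_comm]
    refine Finset.sum_congr rfl fun P _ => ?_
    rw [Finset.sum_comm]
    refine Finset.sum_congr rfl fun p _ => ?_
    have hsnoc : ((∀ r, IsBlock cut (Fin.snocEquiv (fun _ => Fin (ℓ + 1) → Fin n) (p, P) r)) ∧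
        IsChainFrom (K + 1) (Fin.snocEquiv (fun _ => Fin (ℓ + 1) → Fin n) (p, P)) i j) ↔
        ((∀ r, IsBlock cut (P r)) ∧ IsChainFrom K P i (chainSrc K p)) ∧
          (IsBlock cut p ∧ chainTgt K p = j) := by
      simp only [Fin.forall_fin_succ', IsChainFrom, Fin.snocEquiv_apply, Fin.snoc_castSucc,
        Fin.snoc_last]
      tauto
    rw [Finset.sum_eq_single (chainSrc K p)]
    · rw [ite_zero_mul_ite_zero]
      simp only [hsnoc, true_and]
      simp only [Fin.prod_univ_castSucc, Fin.snocEquiv_apply, Fin.snoc_castSucc, Fin.snoc_last]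
    · intro k _ hk
      rw [if_neg (c := IsBlock cut p ∧ _) (fun h => hk h.2.1.symm), mul_zero]
    · simp

end Trace

/-! ### The expected trace. -/

section Expectation

variable {n : ℕ}

/-- The expectation of `f` in the stochastic block model. -/
def expect (a b : ℝ) (n : ℕ) (f : (Fin n → ℤˣ) → SimpleGraph (Fin n) → ℝ) : ℝ :=
  (2 ^ n : ℝ)⁻¹ * ∑ s, ∑ G, (graphLaw a b n s G).toReal * f s G

lemma expect_sum {ι : Type*} (a b : ℝ) (t : Finset ι)
    (f : ι → (Fin n → ℤˣ) → SimpleGraph (Fin n) → ℝ) :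
    expect a b n (fun s G => ∑ i ∈ t, f i s G) = ∑ i ∈ t, expect a b n (f i) := by
  unfold expect
  rw [← Finset.mul_sum, Finset.sum_comm (s := t)]
  congr 1
  refine Finset.sum_congr rfl fun s _ => ?_
  rw [Finset.sum_comm (s := t)]
  exact Finset.sum_congr rfl fun G _ => Finset.mul_sum _ _ _

/-- The number of symbol changes which the encoding of a family of `K` sequences may need beyond
those due to the cycles. -/
def baseChanges (K : ℕ) : ℕ := 3 + 24 * K + 24 * K ^ 2

variable {ℓ K k : ℕ} [NeZero K]

lemma expect_prod_blockWeight_le {a b q ρ z : ℝ} (hn : 0 < n)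
    (hq : ∀ x y, edgePr a b n x y + edgePr a b n x (-y) = 2 * q)
    (hρ : ∀ x y, edgePr a b n x y ≤ ρ) (hq1 : 1 ≤ n * q) (hz0 : 0 < z) (hz1 : z ≤ 1)
    (hρz : ρ ≤ z ^ (12 * K)) (hK : K = 2 * k) {cut : ℕ} (hcut : cut ≤ ℓ)
    {P : Fin K → Fin (ℓ + 1) → Fin n} (hP : ∀ r, IsBlock cut (P r)) {i j : Fin n}
    (hch : IsChainFrom K P i j) :
    expect a b n (fun s G => ∏ r, blockWeight a b s G cut (P r)) ≤
      (if cut < ℓ then ρ else 1) ^ K * (n * (n * q) ^ (k * (ℓ + (ℓ - cut))) *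
        (z ^ baseChanges K)⁻¹) *
        (((n : ℝ)⁻¹) ^ ((Finset.range (familyLength ℓ K + 1)).image (familyWalk P)).card *
      z ^ ({t ∈ Finset.range (familyLength ℓ K) |
        stepCode (familyWalk P) (familyLength ℓ K) t ≠ 0}).card) := by
  have hρ0 : 0 ≤ ρ := (edgePr_nonneg a b n 1 1).trans (hρ 1 1)
  have hn' : (0 : ℝ) < n := by exact_mod_cast hn
  have hq0 : 0 < q := by
    by_contra h
    have : n * q ≤ 0 := mul_nonpos_of_nonneg_of_nonpos hn'.le (not_lt.1 h)
    linarith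
  set D : ℝ := (if cut < ℓ then ρ else 1) ^ K with hD
  have hD0 : 0 ≤ D := by rw [hD]; split_ifs <;> positivity
  obtain ⟨hve, hsum⟩ := sum_prod_edgeWeight_family_le hq hρ hP hch rfl
  have hchg := card_stepCode_familyWalk_le hP
  set v := ((Finset.range (familyLength ℓ K + 1)).image (familyWalk P)).card with hv
  set m := ({t ∈ Finset.range (familyLength ℓ K) |
        stepCode (familyWalk P) (familyLength ℓ K) t ≠ 0}).card with hm
  set e := (familyEdges cut P).card with he
  have hv1 : 1 ≤ v := Finset.card_pos.2
    ⟨_, Finset.mem_image_of_mem _ (Finset.mem_range.2 (Nat.succ_pos _))⟩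
  have hRHS : 0 ≤ D * (n * (n * q) ^ (k * (ℓ + (ℓ - cut))) * (z ^ baseChanges K)⁻¹) *
        (((n : ℝ)⁻¹) ^ v * z ^ m) := by positivity
  have hstep : expect a b n (fun s G => ∏ r, blockWeight a b s G cut (P r)) ≤
      (2 ^ n : ℝ)⁻¹ * ∑ s : Fin n → ℤˣ, D * (if 2 * e ≤ K * (ℓ + (ℓ - cut))
        then ∏ e ∈ familyEdges cut P, edgeWeight a b n s e else 0) := by
    unfold expect
    apply mul_le_mul_of_nonneg_left _ (by positivity)
    refine Finset.sum_le_sum fun s _ => ?_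
    exact (le_abs_self _).trans (abs_expectation_family_le s hρ hcut P hP)
  refine hstep.trans ?_
  by_cases h2e : 2 * e ≤ K * (ℓ + (ℓ - cut))
  · simp only [if_pos h2e]
    rw [← Finset.mul_sum]
    have heH : e ≤ k * (ℓ + (ℓ - cut)) := by
      rw [hK, mul_assoc] at h2e; omega
    -- The factor `n⁻¹ ^ v` is set aside for the count of walks; a tree has one edge fewer than
    -- nodes, which costs a factor `n`.
    have hqv : q ^ (v - 1) = (n * q) ^ (v - 1) * (n * ((n : ℝ)⁻¹) ^ v) := by
      obtain ⟨w, hw⟩ := Nat.exists_eq_add_of_le' hv1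
      rw [hw, Nat.add_sub_cancel, mul_pow, pow_succ, inv_pow]
      field_simp
    -- The excess edges pay for the changes: `ρ ≤ z ^ (12 * K)`, and `m` is at most `baseChanges K +
    -- 12 * K * (e - (v - 1))`.
    have hzx : ρ ^ (e - (v - 1)) ≤ z ^ m * (z ^ baseChanges K)⁻¹ := by
      rw [le_mul_inv_iff₀ (by positivity)]
      calc ρ ^ (e - (v - 1)) * z ^ baseChanges K
          ≤ (z ^ (12 * K)) ^ (e - (v - 1)) * z ^ baseChanges K := by gcongr
        _ = z ^ (12 * K * (e - (v - 1)) + baseChanges K) := by rw [← pow_mul, ← pow_add]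
        _ ≤ z ^ m := by
            apply pow_le_pow_of_le_one hz0.le hz1
            have h1 : 12 * K * e = 12 * K * (e - (v - 1)) + 12 * K * (v - 1) := by
              rw [← mul_add]; congr 1; omega
            unfold baseChanges
            omega
    calc (2 ^ n : ℝ)⁻¹ * (D * ∑ s : Fin n → ℤˣ, ∏ e ∈ familyEdges cut P, edgeWeight a b n s e)
        ≤ (2 ^ n : ℝ)⁻¹ * (D * (2 ^ n * (q ^ (v - 1) * ρ ^ (e - (v - 1))))) := by gcongr
      _ = D * (q ^ (v - 1) * ρ ^ (e - (v - 1))) := by field_simp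
      _ ≤ D * (((n * q) ^ (k * (ℓ + (ℓ - cut))) * (n * ((n : ℝ)⁻¹) ^ v)) *
            (z ^ m * (z ^ baseChanges K)⁻¹)) := by
          rw [hqv]
          gcongr
          -- Here `v - 1 ≤ e ≤ k * (ℓ + (ℓ - cut))`, and `n * q ≥ 1` allows the larger exponent.
          omega
      _ = _ := by ring
  · simpa only [if_neg h2e, mul_zero, Finset.sum_const_zero] using hRHS

/-- For each starting node the sum is enlarged to all families, once the chain condition has been
used for connectivity. This costs a second factor `n`. -/
lemma expect_trace_le {a b q ρ z : ℝ} (hn : 0 < n)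
    (hq : ∀ x y, edgePr a b n x y + edgePr a b n x (-y) = 2 * q)
    (hρ : ∀ x y, edgePr a b n x y ≤ ρ) (hq1 : 1 ≤ n * q) (hz0 : 0 < z) (hz1 : z ≤ 1)
    (hρz : ρ ≤ z ^ (12 * K)) (hK : K = 2 * k) {cut : ℕ} (hcut : cut ≤ ℓ) :
    expect a b n (fun s G => (altProd (blockMatrix a b s G ℓ cut) K).trace) ≤
      n * ((if cut < ℓ then ρ else 1) ^ K * (n * (n * q) ^ (k * (ℓ + (ℓ - cut))) *
        (z ^ baseChanges K)⁻¹) *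
        (1 + (2 * familyLength ℓ K + 2) * z) ^ familyLength ℓ K) := by
  classical
  have hρ0 : 0 ≤ ρ := (edgePr_nonneg a b n 1 1).trans (hρ 1 1)
  simp only [Matrix.trace, Matrix.diag, altProd_blockMatrix_apply]
  rw [expect_sum]
  have hi : ∀ i : Fin n, expect a b n (fun s G =>
      ∑ P : Fin K → Fin (ℓ + 1) → Fin n with (∀ r, IsBlock cut (P r)) ∧ IsChainFrom K P i i,
        ∏ r, blockWeight a b s G cut (P r)) ≤
      (if cut < ℓ then ρ else 1) ^ K * (n * (n * q) ^ (k * (ℓ + (ℓ - cut))) *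
        (z ^ baseChanges K)⁻¹) *
        (1 + (2 * familyLength ℓ K + 2) * z) ^ familyLength ℓ K := by
    intro i
    rw [expect_sum]
    have hcount := sum_weight_stepCode_le (V := Fin n)
      (fun P : Fin K → Fin (ℓ + 1) → Fin n => familyWalk P) (familyLength ℓ K)
      (fun P Q h => familyWalk_determines h) hz0.le
    rw [Fintype.card_fin] at hcount
    have hD0 : 0 ≤ (if cut < ℓ then ρ else 1) ^ K * (n * (n * q) ^ (k * (ℓ + (ℓ - cut))) *
        (z ^ baseChanges K)⁻¹) := by
      have : 0 ≤ (if cut < ℓ then ρ else 1) := by split_ifs <;> positivity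
      have : (0 : ℝ) ≤ n * q := by linarith
      positivity
    refine le_trans ?_ (mul_le_mul_of_nonneg_left hcount hD0)
    rw [Finset.mul_sum]
    refine (Finset.sum_le_sum fun P hP => ?_).trans
      (Finset.sum_le_sum_of_subset_of_nonneg (Finset.subset_univ _) fun P _ _ => ?_)
    · have hP' := (Finset.mem_filter.1 hP).2
      exact expect_prod_blockWeight_le hn hq hρ hq1 hz0 hz1 hρz hK hcut hP'.1 hP'.2
    · positivity
  calc _ ≤ ∑ _i : Fin n, _ := Finset.sum_le_sum fun i _ => hi i
    _ = _ := by rw [Finset.sum_const, Finset.card_univ, Fintype.card_fin, nsmul_eq_mul]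

end Expectation

/-! ### Markov's inequality and the union bound. -/

section Probability

variable {n : ℕ}

lemma expect_mono (a b : ℝ) {f g : (Fin n → ℤˣ) → SimpleGraph (Fin n) → ℝ}
    (h : ∀ s G, f s G ≤ g s G) : expect a b n f ≤ expect a b n g := by
  unfold expect
  apply mul_le_mul_of_nonneg_left _ (by positivity)
  refine Finset.sum_le_sum fun s _ => Finset.sum_le_sum fun G _ => ?_
  exact mul_le_mul_of_nonneg_left (h s G) ENNReal.toReal_nonneg

lemma expect_mul_const (a b : ℝ) (f : (Fin n → ℤˣ) → SimpleGraph (Fin n) → ℝ) (c : ℝ) :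
    expect a b n (fun s G => f s G * c) = expect a b n f * c := by
  unfold expect
  simp_rw [← mul_assoc]
  rw [mul_assoc, Finset.sum_mul]
  simp_rw [Finset.sum_mul]

lemma law_apply (a b : ℝ) (s : Fin n → ℤˣ) (G : SimpleGraph (Fin n)) :
    law a b n (s, G) = ENNReal.ofReal ((2 ^ n : ℝ)⁻¹ * (graphLaw a b n s G).toReal) := by
  classical
  rw [law, PMF.bind_apply, tsum_fintype, Finset.sum_eq_single s]
  · rw [PMF.map_apply, tsum_fintype, Finset.sum_eq_single G]
    · rw [PMF.uniformOfFintype_apply, ENNReal.ofReal_mul (by positivity),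
        ENNReal.ofReal_toReal (PMF.apply_ne_top _ _), if_pos rfl,
        ENNReal.ofReal_inv_of_pos (by positivity)]
      congr 2
      rw [ENNReal.ofReal_pow (by norm_num)]
      simp [Fintype.card_units_int]
    · intro G' _ h
      rw [if_neg]
      intro e
      exact h (Prod.mk.inj e).2.symm
    · simp
  · intro s' _ h
    rw [PMF.map_apply, tsum_fintype, Finset.sum_eq_zero, mul_zero]
    intro G' _
    rw [if_neg]
    intro e
    exact h (Prod.mk.inj e).1.symm
  · simp

/-- Markov's inequality: `f` dominates the indicator of the complement of `S`. -/
lemma one_sub_expect_le (a b : ℝ) (S : Set ((Fin n → ℤˣ) × SimpleGraph (Fin n)))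
    {f : (Fin n → ℤˣ) → SimpleGraph (Fin n) → ℝ} (hf0 : ∀ s G, 0 ≤ f s G)
    (hf : ∀ ω ∉ S, 1 ≤ f ω.1 ω.2) :
    1 - ENNReal.ofReal (expect a b n f) ≤ (law a b n).toOuterMeasure S := by
  classical
  rw [tsub_le_iff_right, PMF.toOuterMeasure_apply_fintype]
  have h1 : (1 : ℝ≥0∞) = ∑ ω, law a b n ω := by
    rw [← tsum_fintype (L := .unconditional _), PMF.tsum_coe]
  have h2 : ENNReal.ofReal (expect a b n f) = ∑ ω, law a b n ω * ENNReal.ofReal (f ω.1 ω.2) := by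
    rw [Fintype.sum_prod_type]
    unfold expect
    rw [Finset.mul_sum, ENNReal.ofReal_sum_of_nonneg]
    · refine Finset.sum_congr rfl fun s _ => ?_
      rw [Finset.mul_sum, ENNReal.ofReal_sum_of_nonneg]
      · refine Finset.sum_congr rfl fun G _ => ?_
        rw [law_apply, ← mul_assoc, ENNReal.ofReal_mul (by positivity)]
      · intro G _
        have := hf0 s G
        positivity
    · intro s _
      apply mul_nonneg (by positivity)
      exact Finset.sum_nonneg fun G _ => mul_nonneg ENNReal.toReal_nonneg (hf0 s G)
  rw [h2, ← Finset.sum_add_distrib, h1]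
  refine Finset.sum_le_sum fun ω _ => ?_
  by_cases hω : ω ∈ S
  · rw [Set.indicator_of_mem hω]
    exact le_self_add
  · rw [Set.indicator_of_notMem hω, zero_add]
    calc law a b n ω = law a b n ω * 1 := (mul_one _).symm
      _ ≤ _ := by
        gcongr
        rw [← ENNReal.ofReal_one]
        exact ENNReal.ofReal_le_ofReal (hf ω hω)

lemma edgePr_add_edgePr_neg {a b : ℝ} (ha : 0 ≤ a) (hb : 0 ≤ b) (hn : max a b ≤ n) (x y : ℤˣ) :
    edgePr a b n x y + edgePr a b n x (-y) = 2 * ((a + b) / 2 / n) := by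
  rw [edgePr_eq ha hb hn, edgePr_eq ha hb hn]
  rcases Int.units_eq_one_or x with rfl | rfl <;> rcases Int.units_eq_one_or y with rfl | rfl <;>
    simp <;> ring

/-- The bound on `specNorm (blockMatrix a b s G ℓ (ℓ - m))` in `goodEvent`. -/
def normBound (a b ε : ℝ) (n ℓ m : ℕ) : ℝ :=
  (n : ℝ) ^ (ε - if m = 0 then 0 else 1) * ((a + b) / 2) ^ (((ℓ : ℝ) + m) / 2)

lemma normBound_pow {a b ε : ℝ} (hn : 0 < n) (hα : 0 ≤ (a + b) / 2) (ℓ m k : ℕ) :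
    normBound a b ε n ℓ m ^ (2 * k) =
      ((n : ℝ) ^ ((2 * k : ℕ) * ε) * (if m = 0 then 1 else (n : ℝ)⁻¹) ^ (2 * k)) *
        ((a + b) / 2) ^ (k * (ℓ + m)) := by
  have hn' : (0 : ℝ) < n := by exact_mod_cast hn
  unfold normBound
  rw [mul_pow]
  congr 1
  · rw [Real.rpow_sub hn', div_eq_mul_inv, mul_pow, mul_comm ((2 * k : ℕ) : ℝ) ε,
      Real.rpow_mul_natCast hn'.le]
    congr 2
    split_ifs
    · simp
    · simp
  · rw [← Real.rpow_mul_natCast hα, ← Real.rpow_natCast]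
    congr 1
    push_cast
    ring

lemma expect_specNorm_pow_le {a b ε : ℝ} (ha : 0 ≤ a) (hb : 0 ≤ b) (hα : 1 ≤ (a + b) / 2)
    (hn : 0 < n) (hab : max a b ≤ n) {j ℓ m : ℕ} (hm : m ≤ ℓ) {Q : ℝ} (hQ1 : 1 ≤ Q)
    (hε : 3 ≤ (2 ^ (j + 2) : ℕ) * ε)
    (hQ : 2 * ((2 ^ (j + 2) : ℕ) * ((ℓ : ℝ) + 1)) ^ 2 ≤ Q)
    (hQn : max a b * Q ^ (12 * 2 ^ (j + 2)) ≤ n) :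
    expect a b n (fun s G => (specNorm (blockMatrix a b s G ℓ (ℓ - m)) /
        normBound a b ε n ℓ m) ^ 2 ^ (j + 2)) ≤
      3 * max (max a b) 1 ^ 2 ^ (j + 2) * Q ^ baseChanges (2 ^ (j + 2)) / n := by
  have hn' : (0 : ℝ) < n := by exact_mod_cast hn
  have hQ0 : 0 < Q := by linarith
  set K := 2 ^ (j + 2) with hK
  set k := 2 ^ (j + 1) with hk
  have hK2 : K = 2 * k := by rw [hK, hk]; ring
  have : NeZero K := ⟨by positivity⟩
  have hρ : ∀ x y, edgePr a b n x y ≤ max a b / n := by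
    intro x y
    rw [edgePr_eq ha hb hab]
    gcongr
    split_ifs
    · exact le_max_left _ _
    · exact le_max_right _ _
  have hmax0 : 0 ≤ max a b := ha.trans (le_max_left _ _)
  have hnq : (n : ℝ) * ((a + b) / 2 / n) = (a + b) / 2 := by field_simp
  have htr := expect_trace_le (ℓ := ℓ) (K := K) (k := k) (cut := ℓ - m) (z := Q⁻¹) hn
    (edgePr_add_edgePr_neg ha hb hab) hρ (by rw [hnq]; exact hα) (by positivity)
    (inv_le_one_of_one_le₀ hQ1) (by
      rw [inv_pow, div_le_iff₀ hn', inv_mul_eq_div, le_div_iff₀ (by positivity)]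
      exact hQn) hK2 (Nat.sub_le _ _)
  rw [hnq, inv_pow, inv_inv, Nat.sub_sub_self hm] at htr
  -- `Q` is at least twice the square of the number of nodes in the concatenation, so this is at
  -- most `exp 1`.
  have hL : (1 + (2 * (familyLength ℓ K : ℝ) + 2) * Q⁻¹) ^ familyLength ℓ K ≤ 3 := by
    have hLs : (familyLength ℓ K : ℝ) + 1 = K * (ℓ + 1) := by
      exact_mod_cast familyLength_succ ℓ K
    set L := familyLength ℓ K with hLdef
    have hL0 : (0 : ℝ) ≤ L := Nat.cast_nonneg L
    have h1 : (2 * (L : ℝ) + 2) * Q⁻¹ * L ≤ 1 := by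
      rw [mul_right_comm, ← div_eq_mul_inv, div_le_one hQ0]
      refine le_trans ?_ hQ
      rw [← hLs]
      nlinarith
    calc (1 + (2 * (L : ℝ) + 2) * Q⁻¹) ^ L ≤ (Real.exp ((2 * (L : ℝ) + 2) * Q⁻¹)) ^ L := by
          apply pow_le_pow_left₀ (by positivity)
          rw [add_comm]
          exact Real.add_one_le_exp _
      _ = Real.exp (L * ((2 * (L : ℝ) + 2) * Q⁻¹)) := (Real.exp_nat_mul _ _).symm
      _ ≤ Real.exp 1 := by
          apply Real.exp_le_exp.2
          rw [mul_comm]; exact h1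
      _ ≤ 3 := by
          have := Real.exp_one_lt_d9
          linarith
  have hB := normBound_pow (ε := ε) hn (by linarith : 0 ≤ (a + b) / 2) ℓ m k
  rw [← hK2] at hB
  have hα0 : 0 < (a + b) / 2 := by linarith
  have hBpos : 0 < normBound a b ε n ℓ m := by unfold normBound; positivity
  set c := max (max a b) 1 with hc
  have hc1 : 1 ≤ c := le_max_right _ _
  have hD : (if ℓ - m < ℓ then max a b / (n : ℝ) else 1) ^ K ≤
      c ^ K * (if m = 0 then 1 else (n : ℝ)⁻¹) ^ K := by
    rw [← mul_pow]
    apply pow_le_pow_left₀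
    · split_ifs <;> positivity
    · rcases Nat.eq_zero_or_pos m with rfl | h
      · simpa using hc1
      · rw [if_pos (by omega), if_neg (by omega), div_eq_mul_inv]
        gcongr
        exact le_max_left _ _
  -- The choice of `K` beats the two lost factors `n` and leaves a spare `1 / n` for the powers of
  -- the logarithm.
  have hn3 : (n : ℝ) ^ 3 ≤ (n : ℝ) ^ ((K : ℕ) * ε) := by
    rw [← Real.rpow_natCast]
    apply Real.rpow_le_rpow_of_exponent_le
    · exact_mod_cast hn
    · simpa using hε
  have hd0 : 0 < (if m = 0 then (1 : ℝ) else (n : ℝ)⁻¹) := by split_ifs <;> positivity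
  set d := (if m = 0 then (1 : ℝ) else (n : ℝ)⁻¹) with hd
  calc expect a b n (fun s G => (specNorm (blockMatrix a b s G ℓ (ℓ - m)) /
        normBound a b ε n ℓ m) ^ K)
      ≤ expect a b n (fun s G => (altProd (blockMatrix a b s G ℓ (ℓ - m)) K).trace *
          (normBound a b ε n ℓ m ^ K)⁻¹) := by
        apply expect_mono
        intro s G
        rw [div_pow, div_eq_mul_inv]
        apply mul_le_mul_of_nonneg_right _ (by positivity)
        rw [hK2, altProd_two_mul, ← hK2]
        exact specNorm_pow_le_trace _ j
    _ = expect a b n (fun s G => (altProd (blockMatrix a b s G ℓ (ℓ - m)) K).trace) *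
          (normBound a b ε n ℓ m ^ K)⁻¹ := expect_mul_const _ _ _ _
    _ ≤ (n * ((c ^ K * d ^ K) * (n * ((a + b) / 2) ^ (k * (ℓ + m)) * Q ^ baseChanges K) * 3)) *
          (normBound a b ε n ℓ m ^ K)⁻¹ := by
        apply mul_le_mul_of_nonneg_right _ (by positivity)
        refine htr.trans ?_
        gcongr
    _ = 3 * c ^ K * Q ^ baseChanges K * (n ^ 2 * ((n : ℝ) ^ ((K : ℕ) * ε))⁻¹) := by
        rw [hB]
        have h0 : (n : ℝ) ^ ((K : ℕ) * ε) ≠ 0 := by positivity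
        field_simp
    _ ≤ 3 * c ^ K * Q ^ baseChanges K * (n ^ 2 * ((n : ℝ) ^ 3)⁻¹) := by
        gcongr
    _ = _ := by field_simp

lemma one_sub_le_law_goodEvent {a b C ε : ℝ} (ha : 0 ≤ a) (hb : 0 ≤ b) (hα : 1 ≤ (a + b) / 2)
    (hn : 0 < n) (hab : max a b ≤ n) (hlog : 1 ≤ Real.log n) {j : ℕ} {Q : ℝ}
    (hε : 3 ≤ (2 ^ (j + 2) : ℕ) * ε)
    (hQ : Q = (2 * (2 ^ (j + 2) : ℕ) * (|C| + 1) * Real.log n) ^ 2)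
    (hQn : max a b * Q ^ (12 * 2 ^ (j + 2)) ≤ n) :
    1 - ENNReal.ofReal (3 * max (max a b) 1 ^ 2 ^ (j + 2) *
        Q ^ (baseChanges (2 ^ (j + 2)) + 1) / n) ≤
      (law a b n).toOuterMeasure (goodEvent a b C ε n) := by
  have hn' : (0 : ℝ) < n := by exact_mod_cast hn
  have hα0 : 0 < (a + b) / 2 := by linarith
  set K := 2 ^ (j + 2) with hK
  have hK1 : (1 : ℝ) ≤ K := by exact_mod_cast Nat.one_le_two_pow
  set c := max (max a b) 1 with hc
  have hc1 : 1 ≤ c := le_max_right _ _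
  -- The absolute value covers negative `C`. The chosen `Q` also dominates `(N + 1) ^ 2`, a bound on
  -- the number of pairs `(ℓ, m)` in the union bound.
  set N := ⌊|C| * Real.log n⌋₊ with hN
  have hN1 : (N : ℝ) + 1 ≤ (|C| + 1) * Real.log n := by
    have : (N : ℝ) ≤ |C| * Real.log n := Nat.floor_le (by positivity)
    linarith
  have hC0 := abs_nonneg C
  have hy1 : 1 ≤ (|C| + 1) * Real.log n := by nlinarith
  have hbase : (|C| + 1) * Real.log n ≤ K * ((|C| + 1) * Real.log n) := by nlinarith
  have hQe : Q = 4 * (K * ((|C| + 1) * Real.log n)) ^ 2 := by rw [hQ]; ring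
  have hQ1 : 1 ≤ Q := by nlinarith
  have hNQ : ((N : ℝ) + 1) ^ 2 ≤ Q := by
    rw [hQe]
    have : (0 : ℝ) ≤ N := Nat.cast_nonneg N
    nlinarith
  let F : ℕ → ℕ → (Fin n → ℤˣ) → SimpleGraph (Fin n) → ℝ := fun ℓ m s G =>
    (specNorm (blockMatrix a b s G ℓ (ℓ - m)) / normBound a b ε n ℓ m) ^ K
  have hF0 : ∀ ℓ m s G, 0 ≤ F ℓ m s G := by
    intro ℓ m s G
    have h1 : 0 ≤ specNorm (blockMatrix a b s G ℓ (ℓ - m)) := norm_nonneg _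
    have h2 : 0 < normBound a b ε n ℓ m := by unfold normBound; positivity
    positivity
  have hF1 : ∀ ℓ m s G, normBound a b ε n ℓ m < specNorm (blockMatrix a b s G ℓ (ℓ - m)) →
      1 ≤ F ℓ m s G := by
    intro ℓ m s G h
    have h2 : 0 < normBound a b ε n ℓ m := by unfold normBound; positivity
    exact one_le_pow₀ ((one_le_div h2).2 h.le)
  have hF1' : ∀ ℓ m s G, ℓ ≤ N → m ≤ ℓ →
      normBound a b ε n ℓ m < specNorm (blockMatrix a b s G ℓ (ℓ - m)) →
      1 ≤ ∑ ℓ ∈ Finset.range (N + 1), ∑ m ∈ Finset.range (ℓ + 1), F ℓ m s G := by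
    intro ℓ m s G hℓ hm h
    refine (hF1 ℓ m s G h).trans ?_
    refine le_trans ?_ (Finset.single_le_sum (f := fun ℓ => ∑ m ∈ Finset.range (ℓ + 1), F ℓ m s G)
      (fun ℓ _ => Finset.sum_nonneg fun m _ => hF0 ℓ m s G)
      (Finset.mem_range.2 (Nat.lt_succ_of_le hℓ)))
    exact Finset.single_le_sum (f := fun m => F ℓ m s G) (fun m _ => hF0 ℓ m s G)
      (Finset.mem_range.2 (Nat.lt_succ_of_le hm))
  have hmain := one_sub_expect_le a b (goodEvent a b C ε n)
    (f := fun s G => ∑ ℓ ∈ Finset.range (N + 1), ∑ m ∈ Finset.range (ℓ + 1), F ℓ m s G)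
    (fun s G => Finset.sum_nonneg fun ℓ _ => Finset.sum_nonneg fun m _ => hF0 ℓ m s G) (by
      rintro ⟨s, G⟩ hω
      simp only [goodEvent, Set.mem_ofPred_eq, not_forall] at hω
      obtain ⟨ℓ, hℓ, hω⟩ := hω
      have hℓN : ℓ ≤ N := by
        apply Nat.le_floor
        exact hℓ.trans (mul_le_mul_of_nonneg_right (le_abs_self C) (by linarith))
      rw [not_and_or] at hω
      rcases hω with h | h
      · apply hF1' ℓ 0 s G hℓN (Nat.zero_le _)
        rw [deltaMatrix_eq_blockMatrix, not_le] at h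
        simpa [normBound] using h
      · simp only [not_forall] at h
        obtain ⟨m, hm, h⟩ := h
        have hm' := Finset.mem_Icc.1 hm
        apply hF1' ℓ m s G hℓN hm'.2
        rw [gammaMatrix_eq_blockMatrix a b s G hm, not_le] at h
        have : m ≠ 0 := by omega
        simpa [normBound, this] using h)
  refine le_trans (tsub_le_tsub_left (ENNReal.ofReal_le_ofReal ?_) 1) hmain
  rw [expect_sum]
  have hterm : ∀ ℓ ∈ Finset.range (N + 1), ∀ m ∈ Finset.range (ℓ + 1),
      expect a b n (F ℓ m) ≤ 3 * c ^ K * Q ^ baseChanges K / n := by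
    intro ℓ hℓ m hm
    have hℓN : (ℓ : ℝ) + 1 ≤ N + 1 := by
      have := Finset.mem_range.1 hℓ
      exact_mod_cast this
    refine expect_specNorm_pow_le ha hb hα hn hab (Nat.lt_succ_iff.1 (Finset.mem_range.1 hm)) hQ1
      hε ?_ hQn
    rw [hQe]
    have h3 : (K : ℝ) * ((ℓ : ℝ) + 1) ≤ K * ((|C| + 1) * Real.log n) := by
      gcongr
      exact hℓN.trans hN1
    have h4 : 0 ≤ (K : ℝ) * ((ℓ : ℝ) + 1) := by positivity
    nlinarith
  have hX : 0 ≤ 3 * c ^ K * Q ^ baseChanges K / n := by positivity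
  calc _ ≤ ∑ ℓ ∈ Finset.range (N + 1), ∑ _m ∈ Finset.range (N + 1),
        3 * c ^ K * Q ^ baseChanges K / n := by
        refine Finset.sum_le_sum fun ℓ hℓ => ?_
        rw [expect_sum]
        refine (Finset.sum_le_sum (hterm ℓ hℓ)).trans ?_
        refine Finset.sum_le_sum_of_subset_of_nonneg ?_ fun _ _ _ => hX
        exact Finset.range_subset_range.2 (Finset.mem_range.1 hℓ)
    _ = ((N : ℝ) + 1) ^ 2 * (3 * c ^ K * Q ^ baseChanges K / n) := by
        simp only [Finset.sum_const, Finset.card_range, nsmul_eq_mul]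
        push_cast
        ring
    _ ≤ Q * (3 * c ^ K * Q ^ baseChanges K / n) := mul_le_mul_of_nonneg_right hNQ hX
    _ = _ := by rw [pow_succ]; ring

lemma tendsto_log_pow_div (D : ℝ) (p : ℕ) :
    Filter.Tendsto (fun n : ℕ => ((D * Real.log n) ^ 2) ^ p / n) Filter.atTop (𝓝 0) := by
  have h : Filter.Tendsto (fun x : ℝ => Real.log x ^ (2 * p) / x) Filter.atTop (𝓝 0) :=
    (Real.isLittleO_pow_log_id_atTop (n := 2 * p)).tendsto_div_nhds_zero
  have h2 := (h.comp tendsto_natCast_atTop_atTop).const_mul (D ^ (2 * p))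
  rw [mul_zero] at h2
  refine h2.congr fun n => ?_
  simp only [Function.comp]
  rw [← pow_mul, mul_pow]
  ring

lemma tendsto_law_goodEvent {a b : ℝ} (ha : 0 ≤ a) (hb : 0 ≤ b) (hα : 1 ≤ (a + b) / 2) (C : ℝ)
    {ε : ℝ} (hε : 0 < ε) :
    Filter.Tendsto (fun n : ℕ => (law a b n).toOuterMeasure (goodEvent a b C ε n))
      Filter.atTop (𝓝 1) := by
  obtain ⟨j, hj⟩ : ∃ j : ℕ, 3 ≤ ((2 ^ (j + 2) : ℕ) : ℝ) * ε := by
    obtain ⟨j, hj⟩ := exists_nat_gt (3 / ε)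
    refine ⟨j, ?_⟩
    rw [div_lt_iff₀ hε] at hj
    refine hj.le.trans ?_
    have : j ≤ 2 ^ (j + 2) := by
      have := Nat.lt_two_pow_self (n := j + 2); omega
    gcongr
  set D : ℝ := 2 * (2 ^ (j + 2) : ℕ) * (|C| + 1) with hD
  have herr : Filter.Tendsto (fun n : ℕ => 1 - ENNReal.ofReal (3 * max (max a b) 1 ^ 2 ^ (j + 2) *
      ((D * Real.log n) ^ 2) ^ (baseChanges (2 ^ (j + 2)) + 1) / n)) Filter.atTop (𝓝 1) := by
    have h := (tendsto_log_pow_div D (baseChanges (2 ^ (j + 2)) + 1)).const_mul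
      (3 * max (max a b) 1 ^ 2 ^ (j + 2))
    rw [mul_zero] at h
    have h2 := ENNReal.tendsto_ofReal h
    have h3 := ENNReal.Tendsto.sub (tendsto_const_nhds (x := (1 : ℝ≥0∞))) h2
      (Or.inl ENNReal.one_ne_top)
    simp only [ENNReal.ofReal_zero, tsub_zero] at h3
    refine h3.congr fun n => ?_
    rw [mul_div_assoc]
  refine tendsto_of_tendsto_of_tendsto_of_le_of_le' herr tendsto_const_nhds ?_ ?_
  · have e1 : ∀ᶠ n : ℕ in Filter.atTop, max a b ≤ n :=
      tendsto_natCast_atTop_atTop.eventually_ge_atTop _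
    have e2 : ∀ᶠ n : ℕ in Filter.atTop, 1 ≤ Real.log n :=
      (Real.tendsto_log_atTop.comp tendsto_natCast_atTop_atTop).eventually_ge_atTop 1
    have e3 : ∀ᶠ n : ℕ in Filter.atTop,
        max a b * (((D * Real.log n) ^ 2) ^ (12 * 2 ^ (j + 2)) / n) < 1 := by
      have h := (tendsto_log_pow_div D (12 * 2 ^ (j + 2))).const_mul (max a b)
      rw [mul_zero] at h
      exact h.eventually_lt_const one_pos
    filter_upwards [e1, e2, e3, Filter.eventually_gt_atTop 0] with n h1 h2 h3 h4
    refine one_sub_le_law_goodEvent ha hb hα h4 h1 h2 hj rfl ?_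
    rw [← mul_div_assoc, div_lt_one (by exact_mod_cast h4)] at h3
    exact h3.le
  · refine Filter.Eventually.of_forall fun n => ?_
    calc (law a b n).toOuterMeasure (goodEvent a b C ε n)
        ≤ (law a b n).toOuterMeasure Set.univ := (law a b n).toOuterMeasure.mono (Set.subset_univ _)
      _ = 1 := (PMF.toOuterMeasure_apply_eq_one_iff _ _).2 (Set.subset_univ _)

end Probability

/-! ### The deterministic expansion of the path matrix. -/

section Expansion

variable {n : ℕ}

open Classical in
lemma pathMatrix_apply (G : SimpleGraph (Fin n)) (ℓ : ℕ) (i j : Fin n) :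
    pathMatrix G ℓ i j = ∑ p : Fin (ℓ + 1) → Fin n with
      Function.Injective p ∧ p 0 = i ∧ p (Fin.last ℓ) = j,
        ∏ t : Fin ℓ, adj G (p t.castSucc) (p t.succ) := by
  have h : ∀ p : Fin (ℓ + 1) → Fin n, ∏ t : Fin ℓ, adj G (p t.castSucc) (p t.succ) =
      if ∀ t : Fin ℓ, G.Adj (p t.castSucc) (p t.succ) then 1 else 0 := by
    intro p
    simp only [adj, SimpleGraph.adjMatrix_apply]
    rw [Finset.prod_ite_zero]
    simp
  simp_rw [h]
  rw [pathMatrix, Matrix.of_apply, Nat.card_eq_fintype_card, Fintype.card_subtype,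
    Finset.sum_boole, Finset.filter_filter]
  congr 2
  ext p
  simp [and_assoc]

/-- With `H c` the product whose first `c` steps are centred, the weight with cut `c` is `H c - H (c
+ 1)`, and the sum telescopes from `H 0` to `H ℓ`. -/
lemma prod_adj_eq_sum_blockWeight (a b : ℝ) (s : Fin n → ℤˣ) (G : SimpleGraph (Fin n)) {ℓ : ℕ}
    (p : Fin (ℓ + 1) → Fin n) :
    ∏ t : Fin ℓ, adj G (p t.castSucc) (p t.succ) =
      blockWeight a b s G ℓ p + ∑ c ∈ Finset.range ℓ, blockWeight a b s G c p := by
  set H : ℕ → ℝ := fun c => ∏ t : Fin ℓ,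
    (if (t : ℕ) < c then adj G - meanAdj a b n s else adj G) (p t.castSucc) (p t.succ) with hH
  have hstep : ∀ c ∈ Finset.range ℓ, blockWeight a b s G c p = H c - H (c + 1) := by
    intro c hc
    have hc' := Finset.mem_range.1 hc
    simp only [hH, blockWeight]
    rw [Fintype.prod_eq_mul_prod_compl (⟨c, hc'⟩ : Fin ℓ),
      Fintype.prod_eq_mul_prod_compl (⟨c, hc'⟩ : Fin ℓ) (fun t : Fin ℓ => (if (t : ℕ) < c then
        adj G - meanAdj a b n s else adj G) (p t.castSucc) (p t.succ)),
      Fintype.prod_eq_mul_prod_compl (⟨c, hc'⟩ : Fin ℓ) (fun t : Fin ℓ => (if (t : ℕ) < c + 1 then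
        adj G - meanAdj a b n s else adj G) (p t.castSucc) (p t.succ))]
    simp only [lt_irrefl, if_false, if_true, Nat.lt_succ_self]
    have e1 : ∏ t ∈ ({⟨c, hc'⟩}ᶜ : Finset (Fin ℓ)), (if (t : ℕ) < c then adj G - meanAdj a b n s
        else if (t : ℕ) = c then meanAdj a b n s else adj G) (p t.castSucc) (p t.succ) =
        ∏ t ∈ ({⟨c, hc'⟩}ᶜ : Finset (Fin ℓ)), (if (t : ℕ) < c then adj G - meanAdj a b n s
        else adj G) (p t.castSucc) (p t.succ) := by
      refine Finset.prod_congr rfl fun t ht => ?_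
      have : (t : ℕ) ≠ c := fun e => by simp [Fin.ext_iff, e] at ht
      rw [if_neg (c := (t : ℕ) = c) this]
    have e2 : ∏ t ∈ ({⟨c, hc'⟩}ᶜ : Finset (Fin ℓ)), (if (t : ℕ) < c + 1 then adj G - meanAdj a b n s
        else adj G) (p t.castSucc) (p t.succ) =
        ∏ t ∈ ({⟨c, hc'⟩}ᶜ : Finset (Fin ℓ)), (if (t : ℕ) < c then adj G - meanAdj a b n s
        else adj G) (p t.castSucc) (p t.succ) := by
      refine Finset.prod_congr rfl fun t ht => ?_
      have : (t : ℕ) ≠ c := fun e => by simp [Fin.ext_iff, e] at ht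
      have : (t : ℕ) < c + 1 ↔ (t : ℕ) < c := by omega
      simp only [this]
    rw [e1, e2, Matrix.sub_apply]
    ring
  rw [Finset.sum_congr rfl hstep, Finset.sum_range_sub']
  have h0 : H 0 = ∏ t : Fin ℓ, adj G (p t.castSucc) (p t.succ) := by simp [hH]
  have h1 : H ℓ = blockWeight a b s G ℓ p := by
    simp only [hH, blockWeight]
    exact Finset.prod_congr rfl fun t _ => by rw [if_pos t.2, if_pos t.2]
  rw [h0, h1]
  ring

/-- The concatenation of two nonempty sequences. -/
def concatSeq {α : Type*} {c d : ℕ} (p : Fin (c + 1) → α) (q : Fin (d + 1) → α) :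
    Fin (c + 1 + d + 1) → α :=
  (Fin.append p q : Fin (c + 1 + (d + 1)) → α)

/-- Cutting a sequence into two nonempty ones. -/
def concatEquiv (α : Type*) (c d : ℕ) :
    (Fin (c + 1) → α) × (Fin (d + 1) → α) ≃ (Fin (c + 1 + d + 1) → α) :=
  Fin.appendEquiv (c + 1) (d + 1)

lemma concatEquiv_apply {α : Type*} {c d : ℕ} (p : Fin (c + 1) → α) (q : Fin (d + 1) → α) :
    concatEquiv α c d (p, q) = concatSeq p q := rfl

lemma concatSeq_left {α : Type*} {c d : ℕ} (p : Fin (c + 1) → α) (q : Fin (d + 1) → α)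
    {x : Fin (c + 1 + d + 1)} (y : Fin (c + 1)) (h : (x : ℕ) = y) : concatSeq p q x = p y := by
  rw [show x = Fin.castAdd (d + 1) y from Fin.ext h]
  exact Fin.append_left p q y

lemma concatSeq_right {α : Type*} {c d : ℕ} (p : Fin (c + 1) → α) (q : Fin (d + 1) → α)
    {x : Fin (c + 1 + d + 1)} (y : Fin (d + 1)) (h : (x : ℕ) = c + 1 + y) :
    concatSeq p q x = q y := by
  rw [show x = Fin.natAdd (c + 1) y from Fin.ext h]
  exact Fin.append_right p q y

lemma blockWeight_concatSeq (a b : ℝ) (s : Fin n → ℤˣ) (G : SimpleGraph (Fin n)) {c d : ℕ}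
    (p : Fin (c + 1) → Fin n) (q : Fin (d + 1) → Fin n) :
    blockWeight a b s G c (concatSeq p q) =
      blockWeight a b s G c p * meanAdj a b n s (p (Fin.last c)) (q 0) *
        ∏ t : Fin d, adj G (q t.castSucc) (q t.succ) := by
  rw [blockWeight, Fin.prod_univ_add, Fin.prod_univ_castSucc]
  congr 1
  · congr 1
    · refine Finset.prod_congr rfl fun t _ => ?_
      rw [concatSeq_left p q (x := Fin.castSucc _) t.castSucc rfl,
        concatSeq_left p q (x := Fin.succ _) t.succ rfl]
      rfl
    · rw [concatSeq_left p q (x := Fin.castSucc _) (Fin.last c) rfl,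
        concatSeq_right p q (x := Fin.succ _) 0 rfl]
      simp
  · refine Finset.prod_congr rfl fun t _ => ?_
    rw [concatSeq_right p q (x := Fin.castSucc _) t.castSucc rfl,
      concatSeq_right p q (x := Fin.succ _) t.succ (by simp; omega)]
    rw [if_neg (by simp; omega), if_neg (by simp; omega)]

lemma injOn_concatSeq_left {α : Type*} {c d : ℕ} (p : Fin (c + 1) → α) (q : Fin (d + 1) → α) :
    Set.InjOn (concatSeq p q) {t | (t : ℕ) ≤ c} ↔ Function.Injective p := by
  constructor
  · intro h x y hxy
    have hx := x.2
    have hy := y.2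
    rw [← concatSeq_left p q (x := ⟨x, by omega⟩) x rfl,
      ← concatSeq_left p q (x := ⟨y, by omega⟩) y rfl] at hxy
    simpa [Fin.ext_iff] using h (Nat.lt_succ_iff.1 hx) (Nat.lt_succ_iff.1 hy) hxy
  · intro h x hx y hy hxy
    have hx' : (x : ℕ) < c + 1 := Nat.lt_succ_of_le hx
    have hy' : (y : ℕ) < c + 1 := Nat.lt_succ_of_le hy
    rw [concatSeq_left p q ⟨x, hx'⟩ rfl, concatSeq_left p q ⟨y, hy'⟩ rfl] at hxy
    exact Fin.ext (Fin.val_eq_of_eq (h hxy) :)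

lemma injOn_concatSeq_right {α : Type*} {c d : ℕ} (p : Fin (c + 1) → α) (q : Fin (d + 1) → α) :
    Set.InjOn (concatSeq p q) {t | c < (t : ℕ)} ↔ Function.Injective q := by
  constructor
  · intro h x y hxy
    have hx := x.2
    have hy := y.2
    rw [← concatSeq_right p q (x := ⟨c + 1 + x, by omega⟩) x rfl,
      ← concatSeq_right p q (x := ⟨c + 1 + y, by omega⟩) y rfl] at hxy
    have := Fin.val_eq_of_eq (h (show c < c + 1 + (x : ℕ) by omega)
      (show c < c + 1 + (y : ℕ) by omega) hxy)
    simp only at this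
    exact Fin.ext (by omega)
  · intro h x hx y hy hxy
    have hx' : c < (x : ℕ) := hx
    have hy' : c < (y : ℕ) := hy
    have hx2 := x.2
    have hy2 := y.2
    rw [concatSeq_right p q ⟨x - (c + 1), by omega⟩ (by simp only; omega),
      concatSeq_right p q ⟨y - (c + 1), by omega⟩ (by simp only; omega)] at hxy
    have := Fin.val_eq_of_eq (h hxy)
    simp only at this
    exact Fin.ext (by omega)

open Classical in
lemma delta_mul_mean_mul_path_apply (a b : ℝ) (s : Fin n → ℤˣ) (G : SimpleGraph (Fin n)) (c d : ℕ)
    (i j : Fin n) :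
    (deltaMatrix a b s G c * meanAdj a b n s * pathMatrix G d) i j =
      ∑ p : Fin (c + 1 + d + 1) → Fin n with
        Set.InjOn p {t : Fin (c + 1 + d + 1) | (t : ℕ) ≤ c} ∧
          Set.InjOn p {t : Fin (c + 1 + d + 1) | c < (t : ℕ)} ∧ p 0 = i ∧
          p (Fin.last (c + 1 + d)) = j, blockWeight a b s G c p := by
  have hΔ : ∀ k, deltaMatrix a b s G c i k = ∑ p : Fin (c + 1) → Fin n,
      if (Function.Injective p ∧ p 0 = i) ∧ p (Fin.last c) = k then
        blockWeight a b s G c p else 0 := by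
    intro k
    rw [deltaMatrix, Matrix.of_apply, Finset.sum_filter]
    refine Finset.sum_congr rfl fun p _ => ?_
    have : blockWeight a b s G c p =
        ∏ t : Fin c, (adj G - meanAdj a b n s) (p t.castSucc) (p t.succ) :=
      Finset.prod_congr rfl fun t _ => by rw [if_pos t.2]
    rw [this]
    simp only [and_assoc]
  have hB : ∀ l, pathMatrix G d l j = ∑ q : Fin (d + 1) → Fin n,
      if (Function.Injective q ∧ q (Fin.last d) = j) ∧ q 0 = l then
        ∏ t : Fin d, adj G (q t.castSucc) (q t.succ) else 0 := by
    intro l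
    rw [pathMatrix_apply, Finset.sum_filter]
    refine Finset.sum_congr rfl fun p _ => ?_
    congr 1
    simp only [eq_iff_iff]
    tauto
  have hL : ∀ l, (deltaMatrix a b s G c * meanAdj a b n s) i l = ∑ p : Fin (c + 1) → Fin n,
      if Function.Injective p ∧ p 0 = i then
        blockWeight a b s G c p * meanAdj a b n s (p (Fin.last c)) l else 0 := by
    intro l
    rw [Matrix.mul_apply]
    simp_rw [hΔ, Finset.sum_mul]
    rw [Finset.sum_comm]
    refine Finset.sum_congr rfl fun p _ => ?_
    rw [Finset.sum_eq_single (p (Fin.last c))]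
    · simp [ite_mul]
    · intro k _ hk
      rw [if_neg (fun h => hk h.2.symm), zero_mul]
    · simp
  rw [Matrix.mul_apply]
  simp_rw [hL, hB, Finset.sum_mul_sum]
  rw [Finset.sum_filter, ← Equiv.sum_comp (concatEquiv (Fin n) c d),
    Fintype.sum_prod_type, Finset.sum_comm]
  refine Finset.sum_congr rfl fun p _ => ?_
  rw [Finset.sum_comm]
  refine Finset.sum_congr rfl fun q _ => ?_
  rw [Finset.sum_eq_single (q 0)]
  · rw [ite_zero_mul_ite_zero]
    have hcond : (Set.InjOn (concatSeq p q) {t | (t : ℕ) ≤ c} ∧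
        Set.InjOn (concatSeq p q) {t | c < (t : ℕ)} ∧
        concatSeq p q (0 : Fin (c + 1 + d + 1)) = i ∧
          concatSeq p q (Fin.last (c + 1 + d)) = j) ↔
        ((Function.Injective p ∧ p 0 = i) ∧
          (Function.Injective q ∧ q (Fin.last d) = j) ∧ q 0 = q 0) := by
      rw [injOn_concatSeq_left, injOn_concatSeq_right, concatSeq_left p q 0 (by simp),
        concatSeq_right p q (Fin.last d) (by simp)]
      tauto
    simp only [concatEquiv_apply, hcond, blockWeight_concatSeq]
  · intro l _ hl
    rw [if_neg (c := _ ∧ q 0 = l) (fun h => hl h.2.symm), mul_zero]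
  · simp

/-- The matrix product sums over pairs of self-avoiding pieces joined by an averaged step; the
concatenation is either self-avoiding or one of the sequences of `Γ`. -/
lemma delta_mul_mean_mul_path_eq (a b : ℝ) (s : Fin n → ℤˣ) (G : SimpleGraph (Fin n)) {ℓ m : ℕ}
    (hm : m ∈ Finset.Icc 1 ℓ) (i j : Fin n) :
    (deltaMatrix a b s G (ℓ - m) * meanAdj a b n s * pathMatrix G (m - 1)) i j =
      open Classical in
      ∑ p : Fin (ℓ + 1) → Fin n with Function.Injective p ∧ p 0 = i ∧ p (Fin.last ℓ) = j,
        blockWeight a b s G (ℓ - m) p + gammaMatrix a b s G ℓ m i j := by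
  classical
  rw [gammaMatrix_eq_blockMatrix a b s G hm]
  have hm' := Finset.mem_Icc.1 hm
  obtain ⟨c, d, hc, hd, hℓ⟩ : ∃ c d, ℓ - m = c ∧ m - 1 = d ∧ ℓ = c + 1 + d :=
    ⟨ℓ - m, m - 1, rfl, rfl, by omega⟩
  rw [hc, hd]
  clear hc hd hm hm'
  subst hℓ
  rw [delta_mul_mean_mul_path_apply, blockMatrix, Matrix.of_apply,
    ← Finset.sum_filter_add_sum_filter_not _ (fun p => Function.Injective p),
    Finset.filter_filter, Finset.filter_filter]
  congr 1
  · refine Finset.sum_congr (Finset.filter_congr fun p _ => ?_) fun p _ => rfl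
    constructor
    · tauto
    · rintro ⟨h, h1, h2⟩
      exact ⟨⟨h.injOn, h.injOn, h1, h2⟩, h⟩
  · refine Finset.sum_congr (Finset.filter_congr fun p _ => ?_) fun p _ => rfl
    have : c < c + 1 + d := by omega
    simp only [IsBlock, this, true_imp_iff]
    tauto

lemma pathMatrix_expansion (a b : ℝ) (s : Fin n → ℤˣ) (G : SimpleGraph (Fin n)) (ℓ : ℕ) :
    pathMatrix G ℓ = deltaMatrix a b s G ℓ +
      ∑ m ∈ Finset.Icc 1 ℓ, deltaMatrix a b s G (ℓ - m) * meanAdj a b n s * pathMatrix G (m - 1) -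
        ∑ m ∈ Finset.Icc 1 ℓ, gammaMatrix a b s G ℓ m := by
  classical
  ext i j
  rw [add_sub_assoc, ← Finset.sum_sub_distrib, Matrix.add_apply, Matrix.sum_apply]
  have h : ∀ m ∈ Finset.Icc 1 ℓ, (deltaMatrix a b s G (ℓ - m) * meanAdj a b n s *
      pathMatrix G (m - 1) - gammaMatrix a b s G ℓ m) i j =
      ∑ p : Fin (ℓ + 1) → Fin n with Function.Injective p ∧ p 0 = i ∧ p (Fin.last ℓ) = j,
        blockWeight a b s G (ℓ - m) p := by
    intro m hm
    rw [Matrix.sub_apply, delta_mul_mean_mul_path_eq a b s G hm]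
    ring
  rw [Finset.sum_congr rfl h, Finset.sum_comm, pathMatrix_apply]
  have hre : ∀ p : Fin (ℓ + 1) → Fin n, ∑ m ∈ Finset.Icc 1 ℓ, blockWeight a b s G (ℓ - m) p =
      ∑ c ∈ Finset.range ℓ, blockWeight a b s G c p := by
    intro p
    refine Finset.sum_nbij' (fun m => ℓ - m) (fun c => ℓ - c) ?_ ?_ ?_ ?_ fun _ _ => rfl
    all_goals
      intro x hx
      simp only [Finset.mem_Icc, Finset.mem_range] at hx ⊢
      omega
  simp_rw [hre, prod_adj_eq_sum_blockWeight a b s G]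
  rw [Finset.sum_add_distrib]
  congr 1
  rw [deltaMatrix, Matrix.of_apply]
  exact Finset.sum_congr rfl fun p _ => Finset.prod_congr rfl fun t _ => by rw [if_pos t.2]

end Expansion

end SBM

end

theorem theorem3 (a b : ℝ) (ha : 0 ≤ a) (hb : 0 ≤ b) :
    -- the conditional mean adjacency matrix is given by the usual formula
    (∀ (n : ℕ) (s : Fin n → ℤˣ), max a b ≤ n →
      SBM.meanAdj a b n s =
        (a / n) • ((1 / 2 : ℝ) • (Matrix.of (fun _ _ => 1) +
            Matrix.vecMulVec (fun i => SBM.spinVal (s i)) (fun i => SBM.spinVal (s i))) - 1) +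
          (b / (2 * n)) • (Matrix.of (fun _ _ => 1) -
            Matrix.vecMulVec (fun i => SBM.spinVal (s i)) (fun i => SBM.spinVal (s i)))) ∧
    -- the expansion
    (∀ (n : ℕ) (s : Fin n → ℤˣ) (G : SimpleGraph (Fin n)) (ℓ : ℕ),
      SBM.pathMatrix G ℓ =
        SBM.deltaMatrix a b s G ℓ +
          ∑ m ∈ Finset.Icc 1 ℓ, SBM.deltaMatrix a b s G (ℓ - m) * SBM.meanAdj a b n s *
            SBM.pathMatrix G (m - 1) -
          ∑ m ∈ Finset.Icc 1 ℓ, SBM.gammaMatrix a b s G ℓ m) ∧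
    -- the bounds, with high probability
    (1 ≤ (a + b) / 2 → ∀ C ε : ℝ, 0 < ε →
      Filter.Tendsto (fun n : ℕ => (SBM.law a b n).toOuterMeasure (SBM.goodEvent a b C ε n))
        Filter.atTop (𝓝 1)) := by
  exact ⟨fun n s hn => SBM.meanAdj_formula ha hb n s hn,
    fun n s G ℓ => SBM.pathMatrix_expansion a b s G ℓ,
    fun hα C ε hε => SBM.tendsto_law_goodEvent ha hb hα C hε⟩
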